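/- Let $\Omega$ be a Polish space with its Borel $\sigma$-algebra and $\mu$ a probability measure on $\Omega$. Let $(P_t)_{t\ge 0}$ be a Markov semigroup of transition kernels on $\Omega$, $P_th(z)=\int h(y)\,P_t(z,dy)$, for which $\mu$ is a stationary distribution, and let $(Z_t)_{t\ge 0}$ be a jointly measurable, time-homogeneous Markov process (not necessarily reversible) with transition semigroup $(P_t)_{t\ge0}$ and $Z_0\sim\mu$. Let $\mathcal L$ be the infinitesimal generator of $(P_t)_{t\ge0}$ on $L^2(\mu)$: $\mathcal L h=\lim_{t\to0+}(P_th-h)/t$ in $L^2(\mu)$, with domain $D(\mathcal L)$ the set of all $h\in L^2(\mu)$ for which this limit exists. Suppose that $\eta_p>0$ is a constant for which the iterated Poincaré inequality $$\operatorname{Var}_\mu[h]\le \eta_p^{-2}\,\mathbb E_\mu\big[(\mathcal L h)^2\big]\qquad\text{for all } h\in D(\mathcal L)$$ holds. Let $f:\Omega\to\mathbb R$ be a measurable function with $\mathbb E_\mu[f]=0$, $|f|\le M$ and $\operatorname{Var}_\mu[f]\le\sigma^2$, where $\sigma\ge0$. (i) If $1-4M^2/\eta_p^2>0$, then for every $t\ge0$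 the following expectation is finite and $$a(t):=\mathbb E_{Z_0\sim\mu}\Big[\exp\Big(\int_0^t f(Z_s)\,ds\Big)\Big]\le\exp\Big(\frac{2\sigma M t}{c\,\eta_p}\Big),\qquad c:=\Big(1-\frac{4M^2}{\eta_p^2}\Big)^{1/2}.$$ (ii) For every $\theta\in\mathbb R$ with $|\theta|<\eta_p/(2M)$ (every $\theta\in\mathbb R$ if $M=0$) and every $t\ge0$, the following expectation is finite and $$\mathbb E_{Z_0\sim\mu}\Big[\exp\Big(\theta\int_0^t f(Z_s)\,ds\Big)\Big]\le\exp\Big(\frac{2\sigma M\theta^2 t}{c(\theta)\,\eta_p}\Big),\qquad c(\theta):=\Big(1-\frac{4\theta^2M^2}{\eta_p^2}\Big)^{1/2}.$$ -/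

import Mathlib

open MeasureTheory ProbabilityTheory Filter Topology
open scoped NNReal ENNReal

/-- A Markov semigroup `(P_t)_{t ≥ 0}` on a measurable space, given by its transition kernels:
probability kernels `P_t(x, dy)` with `P_0(x, ·) = δ_x` and the Chapman-Kolmogorov identity. -/
structure MarkovSemigroup (Ω : Type*) [MeasurableSpace Ω] where
  /-- the transition kernel `P_t(x, dy)` -/
  kernel : ℝ≥0 → Kernel Ω Ω
  isMarkov : ∀ t, IsMarkovKernel (kernel t)
  zero : kernel 0 = Kernel.id
  add : ∀ s t, kernel (s + t) = (kernel t).comp (kernel s)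

namespace MarkovSemigroup

variable {Ω : Type*} [MeasurableSpace Ω]

/-- The action on functions, `(P_t h)(z) = ∫ h(y) P_t(z, dy)`. -/
noncomputable def act (P : MarkovSemigroup Ω) (t : ℝ≥0) (h : Ω → ℝ) (z : Ω) : ℝ :=
  ∫ y, h y ∂(P.kernel t z)

/-- `μ` is a stationary (invariant) distribution: `μ P_t = μ` for all `t`. -/
def IsStationary (P : MarkovSemigroup Ω) (μ : Measure Ω) : Prop :=
  ∀ t, (P.kernel t).Invariant μ

/-- The graph of the infinitesimal generator `𝓛` of the semigroup acting on `L²(μ)`: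
`P.HasGenerator μ h g` says that `h` is in the domain of `𝓛` and `𝓛 h = g`, that is, `h` and `g`
are in `L²(μ)` and `(P_t h - h) / t → g` in `L²(μ)` as `t → 0+`. -/
def HasGenerator (P : MarkovSemigroup Ω) (μ : Measure Ω) (h g : Ω → ℝ) : Prop :=
  MemLp h 2 μ ∧ MemLp g 2 μ ∧
    Tendsto (fun t : ℝ≥0 => eLpNorm (fun z => (P.act t h z - h z) / (t : ℝ) - g z) 2 μ)
      (𝓝[>] 0) (𝓝 0)

/-- The iterated Poincaré inequality with constant `η`:
`Var_μ[h] ≤ η⁻² E_μ[(𝓛 h)²]` for all `h` in the domain of the generator `𝓛` on `L²(μ)`. -/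
def IteratedPoincare (P : MarkovSemigroup Ω) (μ : Measure Ω) (η : ℝ) : Prop :=
  ∀ h g : Ω → ℝ, P.HasGenerator μ h g →
    variance h μ ≤ (η ^ 2)⁻¹ * ∫ z, (g z) ^ 2 ∂μ

/-- `P.Governs μ Pr Z`: `(Z_t)_{t ≥ 0}`, defined on the probability space `(S, Pr)`, is a (jointly measurable)
time-homogeneous Markov process with transition semigroup `P` and initial distribution `μ`:
`Z_0 ∼ μ` and `E[h(Z_{s+t}) | σ(Z_r : r ≤ s)] = (P_t h)(Z_s)` almost surely, for all `s, t ≥ 0` and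
all bounded measurable `h`. -/
structure Governs (P : MarkovSemigroup Ω) (μ : Measure Ω)
    {S : Type*} [MeasurableSpace S] (Pr : Measure S) (Z : ℝ≥0 → S → Ω) : Prop where
  measurable : Measurable (fun p : ℝ≥0 × S => Z p.1 p.2)
  initial : Pr.map (Z 0) = μ
  markov : ∀ (s t : ℝ≥0) (h : Ω → ℝ), Measurable h → (∃ C : ℝ, ∀ x, |h x| ≤ C) →
    Pr[fun w => h (Z (s + t) w) | ⨆ r ≤ s, MeasurableSpace.comap (Z r) inferInstance]
      =ᵐ[Pr] fun w => P.act t h (Z s w)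

end MarkovSemigroup

/-- The additive functional `∫_0^t f(Z_s) ds` along the path `s ↦ Z_s(w)`, for `t ≥ 0`. -/
noncomputable def pathIntegral {Ω S : Type*} (f : Ω → ℝ) (Z : ℝ≥0 → S → Ω) (t : ℝ) (w : S) : ℝ :=
  ∫ s in (0 : ℝ)..t, f (Z s.toNNReal w)

/-!
Write `A_t = ∫_0^t f(Z_s) ds`, `a(t) = E[exp A_t]` and `G_t = ∫_0^t exp A_s ds` (`expFunctional`),
and let `U` be the function with `U(Z_0) = E[G_t | Z_0]`, so that `∫ U dμ = ∫_0^t a(s) ds`.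
In semigroup terms `U = ∫_0^t Q_s 1 ds` with `Q` the Feynman-Kac semigroup of `𝓛 + f`. Hence `U`
lies in the domain of `𝓛`, and `(𝓛 U)(Z_0) = E[exp A_t - 1 | Z_0] - f(Z_0) U(Z_0)`
(`hasGenerator_of_ae_eq_condExp`). Three consequences give the bound
(`integral_exp_pathIntegral_le_one_add`):

* Pathwise `exp A_t - 1 = ∫_0^t f(Z_s) exp A_s ds`, so `|exp A_t - 1| ≤ M G_t` and therefore
  `|𝓛 U| ≤ 2 M U`. The iterated Poincaré inequality becomes
  `Var U ≤ (4 M² / η²) (Var U + (∫ U dμ)²)`, that is, `√(Var U) ≤ 2 M / (c η) ∫ U dμ`.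
* The mean of `𝓛 U` vanishes by stationarity, so `a(t) - 1 = ∫ f U dμ`.
* Since `f` is centred, `∫ f U dμ ≤ σ √(Var U)`.

Together `a(t) ≤ 1 + K ∫_0^t a(s) ds` with `K = 2 σ M / (c η)`, and Grönwall's lemma
(`le_exp_of_le_one_add_integral`) finishes the proof. The statement with a parameter `θ` is the
one for the function `θ f`.

No regularity in `t` of the transition kernels is assumed, so membership in the domain of `𝓛` is
proved from the process. The function `P_δ U` represents `E[G_t ∘ shift_δ | Z_0]`
(`act_ae_eq_condExp_shift`). This is the Markov property for a functional of the whole path, which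
follows from products along finitely many times (`integral_mul_prod_eq`), since the exponential
moments of time integrals are determined by such products (`integral_mul_exp_eq_of_moments`).
The difference quotient `(G_t ∘ shift_δ - G_t) / δ` is computed along each path
(`abs_shift_diffQuotient_le`), and the only error that is not `O(δ)` is
`A_δ / δ - f(Z_0)`. It tends to `0` in `L²` (`tendsto_integral_sq_average_sub`), by stationarity
and Lebesgue's differentiation theorem along the paths.
-/

/-! ### Bounded measurable functions -/

/-- `h` is a bounded measurable real function. -/
def BddMeasurable {α : Type*} [MeasurableSpace α] (h : α → ℝ) : Prop :=
  Measurable h ∧ ∃ C : ℝ, ∀ x, |h x| ≤ C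

namespace BddMeasurable

variable {α β : Type*} {mα : MeasurableSpace α} {mβ : MeasurableSpace β} {g h : α → ℝ}

theorem const (c : ℝ) : BddMeasurable (fun _ : α => c) := ⟨measurable_const, |c|, fun _ => le_rfl⟩

theorem mul (hg : BddMeasurable g) (hh : BddMeasurable h) :
    BddMeasurable (fun x => g x * h x) := by
  obtain ⟨hg, C, hC⟩ := hg
  obtain ⟨hh, D, hD⟩ := hh
  refine ⟨hg.mul hh, C * D, fun x => ?_⟩
  rw [abs_mul]
  exact mul_le_mul (hC x) (hD x) (abs_nonneg _) ((abs_nonneg _).trans (hC x))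

theorem sub (hg : BddMeasurable g) (hh : BddMeasurable h) :
    BddMeasurable (fun x => g x - h x) := by
  obtain ⟨hg, C, hC⟩ := hg
  obtain ⟨hh, D, hD⟩ := hh
  exact ⟨hg.sub hh, C + D, fun x => (abs_sub _ _).trans (add_le_add (hC x) (hD x))⟩

theorem const_mul (c : ℝ) (hh : BddMeasurable h) : BddMeasurable (fun x => c * h x) :=
  (const c).mul hh

theorem pow (hh : BddMeasurable h) (n : ℕ) : BddMeasurable (fun x => h x ^ n) := by
  induction n with
  | zero => simpa using const (α := α) 1
  | succ n ih => simpa only [pow_succ] using ih.mul hh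

theorem comp {φ : β → α} (hh : BddMeasurable h) (hφ : Measurable φ) :
    BddMeasurable (fun x => h (φ x)) :=
  ⟨hh.1.comp hφ, hh.2.choose, fun x => hh.2.choose_spec (φ x)⟩

theorem mono {m m' : MeasurableSpace α} (hm : m ≤ m') (hh : @BddMeasurable α m h) :
    @BddMeasurable α m' h :=
  ⟨hh.1.mono hm le_rfl, hh.2⟩

theorem memLp {ν : Measure α} [IsFiniteMeasure ν] (hh : BddMeasurable h) (p : ℝ≥0∞) :
    MemLp h p ν :=
  MemLp.of_bound hh.1.aestronglyMeasurable hh.2.choose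
    (Eventually.of_forall fun x => by simpa using hh.2.choose_spec x)

theorem integrable {ν : Measure α} [IsFiniteMeasure ν] (hh : BddMeasurable h) : Integrable h ν :=
  memLp_one_iff_integrable.1 (hh.memLp 1)

end BddMeasurable

/-! ### The Markov property for products along finitely many times -/

namespace MarkovSemigroup

variable {Ω : Type*} [MeasurableSpace Ω]

theorem bddMeasurable_act (P : MarkovSemigroup Ω) (t : ℝ≥0) {h : Ω → ℝ} (hh : BddMeasurable h) :
    BddMeasurable (P.act t h) := by
  have := P.isMarkov t
  obtain ⟨hm, C, hC⟩ := hh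
  refine ⟨(hm.stronglyMeasurable.integral_kernel (κ := P.kernel t)).measurable, C, fun z => ?_⟩
  have := norm_integral_le_of_norm_le_const (μ := P.kernel t z) (f := h) (C := C)
    (Eventually.of_forall hC)
  simpa [act] using this

theorem integral_act {P : MarkovSemigroup Ω} {μ : Measure Ω} [IsProbabilityMeasure μ]
    (hμ : P.IsStationary μ) (t : ℝ≥0) {h : Ω → ℝ} (hh : BddMeasurable h) :
    ∫ z, P.act t h z ∂μ = ∫ z, h z ∂μ := by
  have := P.isMarkov t
  have h1 : Integrable h (μ.bind (P.kernel t)) := by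
    rw [(hμ t).def]; exact hh.integrable
  conv_rhs => rw [← (hμ t).def]
  rw [Measure.comp_eq_comp_const_apply] at h1 ⊢
  rw [Kernel.integral_comp h1, Kernel.const_apply]
  rfl

section Past

variable {S : Type*}

/-- The σ-algebra of the past `σ(Z_r : r ≤ s)`. -/
abbrev past (Z : ℝ≥0 → S → Ω) (s : ℝ≥0) : MeasurableSpace S :=
  ⨆ r ≤ s, MeasurableSpace.comap (Z r) inferInstance

theorem measurable_past (Z : ℝ≥0 → S → Ω) {r s : ℝ≥0} (h : r ≤ s) :
    Measurable[past Z s] (Z r) :=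
  (comap_measurable (Z r)).mono
    (le_iSup₂ (f := fun r (_ : r ≤ s) => MeasurableSpace.comap (Z r) inferInstance) r h) le_rfl

theorem past_mono (Z : ℝ≥0 → S → Ω) {r s : ℝ≥0} (h : r ≤ s) : past Z r ≤ past Z s :=
  iSup₂_le fun _ hq => (measurable_past Z (hq.trans h)).comap_le

end Past

variable {S : Type*} [mS : MeasurableSpace S]

namespace Governs

variable {P : MarkovSemigroup Ω} {μ : Measure Ω} {Pr : Measure S} {Z : ℝ≥0 → S → Ω}

theorem measurable_eval (hZ : P.Governs μ Pr Z) (s : ℝ≥0) : Measurable (Z s) :=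
  hZ.measurable.comp measurable_prodMk_left

theorem past_le (hZ : P.Governs μ Pr Z) (s : ℝ≥0) : past Z s ≤ mS :=
  iSup₂_le fun r _ => (hZ.measurable_eval r).comap_le

variable [IsProbabilityMeasure Pr]

/-- The Markov property tested against a weight `W` that depends on the past. -/
theorem integral_mul_act (hZ : P.Governs μ Pr Z) {s t : ℝ≥0} {W : S → ℝ}
    (hW : @BddMeasurable S (past Z s) W) {h : Ω → ℝ} (hh : BddMeasurable h) :
    ∫ w, W w * h (Z (s + t) w) ∂Pr = ∫ w, W w * P.act t h (Z s w) ∂Pr := by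
  have hm := hZ.past_le s
  obtain ⟨C, hC⟩ := hW.2
  have h1 := condExp_stronglyMeasurable_mul_of_bound hm (μ := Pr)
    (f := W) (g := fun w => h (Z (s + t) w)) hW.1.stronglyMeasurable
    (hh.comp (hZ.measurable_eval (s + t))).integrable C
    (Eventually.of_forall hC)
  have h2 := hZ.markov s t h hh.1 hh.2
  calc ∫ w, W w * h (Z (s + t) w) ∂Pr
      = ∫ w, (Pr[W * fun w => h (Z (s + t) w) | past Z s]) w ∂Pr := (integral_condExp hm).symm
    _ = ∫ w, W w * P.act t h (Z s w) ∂Pr := by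
      apply integral_congr_ae
      filter_upwards [h1, h2] with w hw1 hw2
      rw [hw1, Pi.mul_apply, hw2]

/-- Under a stationary initial distribution every `Z_t` has law `μ`. -/
theorem integral_eval [IsProbabilityMeasure μ] (hZ : P.Governs μ Pr Z) (hμ : P.IsStationary μ)
    (t : ℝ≥0) {h : Ω → ℝ} (hh : BddMeasurable h) :
    ∫ w, h (Z t w) ∂Pr = ∫ z, h z ∂μ := by
  have h1 := hZ.integral_mul_act (s := 0) (t := t) (BddMeasurable.const 1) hh
  simp only [one_mul, zero_add] at h1
  rw [h1, ← integral_act hμ t hh, ← hZ.initial,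
    integral_map (hZ.measurable_eval 0).aemeasurable]
  exact (bddMeasurable_act P t hh).1.aestronglyMeasurable

/-- Along an increasing list of times the expectation of a product of values of the process reduces
to a function `k` of the state at the first time `d + b`. The function `k` depends neither on the
starting time `d` nor on the weight `W`, which expresses time-homogeneity. -/
theorem exists_integral_mul_prod_sorted (hZ : P.Governs μ Pr Z) {f : Ω → ℝ}
    (hf : BddMeasurable f) (l : List ℝ≥0) (b : ℝ≥0) (hl : (b :: l).Pairwise (· ≤ ·)) :
    ∃ k : Ω → ℝ, BddMeasurable k ∧ ∀ (d : ℝ≥0) (W : S → ℝ),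
      @BddMeasurable S (past Z (d + b)) W →
      ∫ w, W w * (l.map fun r => f (Z (d + r) w)).prod ∂Pr = ∫ w, W w * k (Z (d + b) w) ∂Pr := by
  induction l generalizing b with
  | nil => exact ⟨fun _ => 1, .const 1, fun d W _ => by simp⟩
  | cons a l ih =>
    rw [List.pairwise_cons] at hl
    have hba : b ≤ a := hl.1 a (by simp)
    obtain ⟨k, hk, hk'⟩ := ih a hl.2
    refine ⟨P.act (a - b) fun x => f x * k x, bddMeasurable_act _ _ (hf.mul hk),
      fun d W hW => ?_⟩
    have e : d + b + (a - b) = d + a := by rw [add_assoc, add_tsub_cancel_of_le hba]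
    have hab : d + b ≤ d + a := by gcongr
    have h1 := hk' d (fun w => W w * f (Z (d + a) w))
      ((hW.mono (past_mono Z hab)).mul (hf.comp (measurable_past Z le_rfl)))
    have h2 := hZ.integral_mul_act (t := a - b) hW (hf.mul hk)
    rw [e] at h2
    rw [← h2]
    simpa only [List.map_cons, List.prod_cons, mul_assoc] using h1

/-- Two weights, one at time `d` and one at time `0`, that agree on functions of the present state
also agree on all products of values of the process at later times. -/
theorem integral_mul_prod_eq (hZ : P.Governs μ Pr Z) {f : Ω → ℝ}
    (hf : BddMeasurable f) {d : ℝ≥0} {W W' : S → ℝ} (hW : @BddMeasurable S (past Z d) W)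
    (hW' : @BddMeasurable S (past Z 0) W')
    (h : ∀ k : Ω → ℝ, BddMeasurable k →
      ∫ w, W w * k (Z d w) ∂Pr = ∫ w, W' w * k (Z 0 w) ∂Pr)
    {n : ℕ} (r : Fin n → ℝ≥0) :
    ∫ w, W w * ∏ i, f (Z (d + r i) w) ∂Pr = ∫ w, W' w * ∏ i, f (Z (r i) w) ∂Pr := by
  have key : ∀ (φ : ℝ≥0 → ℝ), ∏ i, φ (r i) =
      (((Finset.univ.val.map r).sort (· ≤ ·)).map φ).prod := by
    intro φ
    rw [← Multiset.prod_coe, ← Multiset.map_coe, Multiset.sort_eq, Multiset.map_map]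
    rfl
  obtain ⟨k, hk, hk'⟩ := hZ.exists_integral_mul_prod_sorted hf
    ((Finset.univ.val.map r).sort (· ≤ ·)) 0
    (List.pairwise_cons.2 ⟨fun _ _ => zero_le, Multiset.pairwise_sort _ _⟩)
  have h1 := hk' d W (by rwa [add_zero])
  have h2 := hk' 0 W' (by rwa [add_zero])
  simp only [add_zero, zero_add] at h1 h2
  simp only [fun w => key fun r => f (Z (d + r) w), fun w => key fun r => f (Z r w)]
  rw [h1, h2, h k hk]

end Governs
end MarkovSemigroup

/-! ### Exponentials of integrals along a single bounded path -/

theorem abs_exp_sub_exp_le {a b c : ℝ} (ha : a ≤ c) (hb : b ≤ c) :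
    |Real.exp a - Real.exp b| ≤ Real.exp c * |a - b| := by
  wlog hab : b ≤ a generalizing a b
  · rw [abs_sub_comm, abs_sub_comm a]
    exact this hb ha (le_of_not_ge hab)
  rw [abs_of_nonneg (sub_nonneg.2 (Real.exp_le_exp.2 hab)), abs_of_nonneg (sub_nonneg.2 hab)]
  have h1 : Real.exp b = Real.exp a * Real.exp (b - a) := by rw [← Real.exp_add]; congr 1; ring
  have h2 := Real.add_one_le_exp (b - a)
  calc Real.exp a - Real.exp b = Real.exp a * (1 - Real.exp (b - a)) := by rw [h1]; ring
    _ ≤ Real.exp a * (a - b) := mul_le_mul_of_nonneg_left (by linarith) (Real.exp_pos _).le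
    _ ≤ Real.exp c * (a - b) :=
      mul_le_mul_of_nonneg_right (Real.exp_le_exp.2 ha) (sub_nonneg.2 hab)

section Path

variable {x : ℝ → ℝ} {M : ℝ}

theorem BddMeasurable.locallyIntegrable (hx : BddMeasurable x) : LocallyIntegrable x volume :=
  (memLp_top_of_bound hx.1.aestronglyMeasurable hx.2.choose
    (Eventually.of_forall fun s => hx.2.choose_spec s)).locallyIntegrable le_top

theorem BddMeasurable.intervalIntegrable (hx : BddMeasurable x) (a b : ℝ) :
    IntervalIntegrable x volume a b :=
  (hx.locallyIntegrable.integrableOn_isCompact isCompact_uIcc).intervalIntegrable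

theorem abs_integral_sub_integral_le (hx : Measurable x) (hM : ∀ s, |x s| ≤ M) (s t : ℝ) :
    |(∫ r in (0 : ℝ)..t, x r) - ∫ r in (0 : ℝ)..s, x r| ≤ M * |t - s| := by
  have hx' : BddMeasurable x := ⟨hx, M, hM⟩
  rw [intervalIntegral.integral_interval_sub_left (hx'.intervalIntegrable _ _)
    (hx'.intervalIntegrable _ _)]
  exact intervalIntegral.norm_integral_le_of_norm_le_const (f := x) fun r _ => hM r

theorem abs_integral_le (hx : Measurable x) (hM : ∀ s, |x s| ≤ M) (t : ℝ) :
    |∫ r in (0 : ℝ)..t, x r| ≤ M * |t| := by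
  simpa using abs_integral_sub_integral_le hx hM 0 t

theorem continuous_integral_path (hx : Measurable x) (hM : ∀ s, |x s| ≤ M) :
    Continuous fun t => ∫ r in (0 : ℝ)..t, x r :=
  intervalIntegral.continuous_primitive
    (fun a b => BddMeasurable.intervalIntegrable ⟨hx, M, hM⟩ a b) 0

/-- The fundamental theorem of calculus for `exp (∫ x)`, where `x` is merely bounded and
measurable. -/
theorem exp_integral_sub_one (hx : Measurable x) (hM : ∀ s, |x s| ≤ M) (t : ℝ) :
    Real.exp (∫ r in (0 : ℝ)..t, x r) - 1 =
      ∫ s in (0 : ℝ)..t, x s * Real.exp (∫ r in (0 : ℝ)..s, x r) := by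
  have hM0 : 0 ≤ M := (abs_nonneg _).trans (hM 0)
  have hac : AbsolutelyContinuousOnInterval
      (fun s => Real.exp (∫ r in (0 : ℝ)..s, x r)) 0 t := by
    apply LipschitzOnWith.absolutelyContinuousOnInterval
      (K := Real.toNNReal (Real.exp (M * |t|) * M))
    have hb : ∀ s ∈ Set.uIcc 0 t, ∫ r in (0 : ℝ)..s, x r ≤ M * |t| := fun s hs => by
      refine (le_abs_self _).trans ((abs_integral_le hx hM s).trans ?_)
      have : |s| ≤ |t| := by simpa using Set.abs_sub_left_of_mem_uIcc hs
      gcongr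
    refine LipschitzOnWith.of_dist_le_mul fun u hu v hv => ?_
    rw [Real.coe_toNNReal _ (by positivity), Real.dist_eq, Real.dist_eq, mul_assoc]
    refine (abs_exp_sub_exp_le (hb u hu) (hb v hv)).trans ?_
    gcongr
    exact abs_integral_sub_integral_le hx hM v u
  have h0 := hac.integral_deriv_eq_sub
  simp only [intervalIntegral.integral_same, Real.exp_zero] at h0
  rw [← h0]
  apply intervalIntegral.integral_congr_ae
  filter_upwards [LocallyIntegrable.ae_hasDerivAt_integral
    (BddMeasurable.locallyIntegrable (x := x) ⟨hx, M, hM⟩)] with s hs _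
  rw [(hs 0).exp.deriv, mul_comm]

theorem abs_exp_integral_sub_one_le (hx : Measurable x) (hM : ∀ s, |x s| ≤ M) {t : ℝ}
    (ht : 0 ≤ t) :
    |Real.exp (∫ r in (0 : ℝ)..t, x r) - 1| ≤
      M * ∫ s in (0 : ℝ)..t, Real.exp (∫ r in (0 : ℝ)..s, x r) := by
  rw [exp_integral_sub_one hx hM, ← intervalIntegral.integral_const_mul, ← Real.norm_eq_abs]
  refine intervalIntegral.norm_integral_le_of_norm_le ht (Eventually.of_forall fun s _ => ?_)
    (((Real.continuous_exp.comp (continuous_integral_path hx hM)).const_mul M).intervalIntegrable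
      _ _)
  rw [norm_mul, Real.norm_eq_abs, Real.norm_eq_abs, Real.abs_exp]
  gcongr
  exact hM s

/-- The difference quotient, under a time shift by `δ`, of `∫_0^t exp (∫_0^s x) ds` is close to
`exp (∫_0^t x) - 1 - x₀ ∫_0^t exp (∫_0^s x) ds`, up to `O(δ)` and up to the distance from `x₀` to
the average of `x` over `[0, δ]`. -/
theorem abs_shift_diffQuotient_le (hx : Measurable x) (hM : ∀ s, |x s| ≤ M) {t δ : ℝ}
    (ht : 0 ≤ t) (hδ : 0 < δ) (hδ1 : δ ≤ 1) (hMδ : M * δ ≤ 1) (x₀ : ℝ) :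
    |((∫ s in (0 : ℝ)..t, Real.exp (∫ r in (0 : ℝ)..s, x (δ + r))) -
          ∫ s in (0 : ℝ)..t, Real.exp (∫ r in (0 : ℝ)..s, x r)) / δ -
        (Real.exp (∫ r in (0 : ℝ)..t, x r) - 1 -
          x₀ * ∫ s in (0 : ℝ)..t, Real.exp (∫ r in (0 : ℝ)..s, x r))| ≤
      Real.exp (M * (t + 2)) * (4 * M + t * M ^ 2) * δ +
        Real.exp (M * (t + 2)) * t * |(∫ r in (0 : ℝ)..δ, x r) / δ - x₀| := by
  have hM0 : 0 ≤ M := (abs_nonneg _).trans (hM 0)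
  have hLip := abs_integral_sub_integral_le hx hM
  have hcont := continuous_integral_path hx hM
  have hA0 : ∫ r in (0 : ℝ)..0, x r = 0 := intervalIntegral.integral_same
  have hshift : ∀ s, ∫ r in (0 : ℝ)..s, x (δ + r) =
      (∫ r in (0 : ℝ)..(δ + s), x r) - ∫ r in (0 : ℝ)..δ, x r := fun s => by
    have hx' : BddMeasurable x := ⟨hx, M, hM⟩
    rw [intervalIntegral.integral_comp_add_left x δ, add_zero,
      intervalIntegral.integral_interval_sub_left (hx'.intervalIntegrable _ _)
        (hx'.intervalIntegrable _ _)]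
  simp only [hshift]
  obtain ⟨A, hA⟩ : ∃ A : ℝ → ℝ, ∀ t, ∫ r in (0 : ℝ)..t, x r = A t := ⟨_, fun _ => rfl⟩
  simp only [hA] at hLip hcont hA0 ⊢
  clear hshift
  have hc : ∀ c, Continuous fun s => Real.exp (A s - c) := fun c => by fun_prop
  have hc0 : Continuous fun s => Real.exp (A s) := by fun_prop
  set E := Real.exp (M * (t + 2)) with hE
  set G := ∫ s in (0 : ℝ)..t, Real.exp (A s) with hG
  have hAδ : |A δ| ≤ M * δ := by simpa [hA0, abs_of_pos hδ] using hLip 0 δ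
  -- the shifted integral, cut at the points `0`, `δ`, `t`, `t + δ`
  have h1 : ∫ s in (0 : ℝ)..t, Real.exp (A (δ + s) - A δ) =
      (∫ s in t..(t + δ), Real.exp (A s - A δ)) - (∫ s in (0 : ℝ)..δ, Real.exp (A s - A δ)) +
        Real.exp (-A δ) * G := by
    rw [intervalIntegral.integral_comp_add_left (fun s => Real.exp (A s - A δ)) δ, add_zero,
      hG, ← intervalIntegral.integral_const_mul]
    have h2 : ∀ s, Real.exp (-A δ) * Real.exp (A s) = Real.exp (A s - A δ) := fun s => by
      rw [← Real.exp_add]; congr 1; ring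
    simp only [h2]
    have h3 := intervalIntegral.integral_add_adjacent_intervals
      ((hc (A δ)).intervalIntegrable (μ := volume) 0 δ)
      ((hc (A δ)).intervalIntegrable δ (δ + t))
    have h4 := intervalIntegral.integral_add_adjacent_intervals
      ((hc (A δ)).intervalIntegrable (μ := volume) 0 t)
      ((hc (A δ)).intervalIntegrable t (t + δ))
    rw [add_comm t δ] at h4 ⊢
    linarith
  -- over an interval of length `δ` starting at `u` the integrand is almost constant
  have h2 : ∀ u, 0 ≤ u → u ≤ t →
      |(∫ s in u..(u + δ), Real.exp (A s - A δ)) - δ * Real.exp (A u)| ≤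
        E * (2 * M * δ) * δ := by
    intro u hu hut
    have h3 : (∫ s in u..(u + δ), Real.exp (A s - A δ)) - δ * Real.exp (A u) =
        ∫ s in u..(u + δ), (Real.exp (A s - A δ) - Real.exp (A u)) := by
      rw [intervalIntegral.integral_sub ((hc (A δ)).intervalIntegrable _ _)
        intervalIntegrable_const]
      simp
    rw [h3]
    have h4 := intervalIntegral.norm_integral_le_of_norm_le_const (a := u) (b := u + δ)
      (C := E * (2 * M * δ)) (f := fun s => Real.exp (A s - A δ) - Real.exp (A u))
      (fun s hs => ?_)
    · simpa [abs_of_pos hδ] using h4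
    · rw [Set.uIoc_of_le (by linarith)] at hs
      have e1 := hLip u s
      rw [abs_of_nonneg (show 0 ≤ s - u by linarith [hs.1])] at e1
      have e2 : |A u| ≤ M * u := by simpa [hA0, abs_of_nonneg hu] using hLip 0 u
      have e3 : M * (s - u) ≤ M * δ := by gcongr; linarith [hs.2]
      have e4 : M * u ≤ M * t := by gcongr
      have e5 : M * δ ≤ M := by nlinarith
      rw [Real.norm_eq_abs]
      refine (abs_exp_sub_exp_le (c := M * (t + 2)) ?_ ?_).trans ?_
      · rw [abs_le] at *; linarith
      · rw [abs_le] at *; linarith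
      · gcongr
        rw [abs_le] at *
        constructor <;> linarith
  have h3 := h2 0 le_rfl ht
  have h4 := h2 t ht le_rfl
  rw [hA0, Real.exp_zero, zero_add, mul_one] at h3
  have hG0 : 0 ≤ G := intervalIntegral.integral_nonneg ht fun s _ => (Real.exp_pos _).le
  have hGE : G ≤ E * t := by
    have := intervalIntegral.norm_integral_le_of_norm_le_const (a := 0) (b := t)
      (C := E) (f := fun s => Real.exp (A s)) (fun s hs => ?_)
    · rw [sub_zero, abs_of_nonneg ht] at this
      exact (le_abs_self _).trans this
    · rw [Set.uIoc_of_le ht] at hs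
      rw [Real.norm_eq_abs, Real.abs_exp, hE, Real.exp_le_exp]
      have e2 : |A s| ≤ M * s := by simpa [hA0, abs_of_pos hs.1] using hLip 0 s
      refine (le_abs_self _).trans (e2.trans ?_)
      gcongr
      linarith [hs.2]
  have h5 : |Real.exp (-A δ) - 1 + A δ| ≤ (M * δ) ^ 2 := by
    have := Real.abs_exp_sub_one_sub_id_le (x := -A δ) (by rw [abs_neg]; linarith)
    rw [sub_neg_eq_add] at this
    refine this.trans ?_
    rw [neg_sq, ← sq_abs]
    gcongr
  have h6 : |A δ - δ * x₀| = δ * |A δ / δ - x₀| := by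
    rw [← abs_of_pos hδ, ← abs_mul, abs_of_pos hδ]
    congr 1
    field_simp
  rw [h1]
  have h7 : ((∫ s in t..(t + δ), Real.exp (A s - A δ)) -
        (∫ s in (0 : ℝ)..δ, Real.exp (A s - A δ)) + Real.exp (-A δ) * G - G) / δ -
        (Real.exp (A t) - 1 - x₀ * G) =
      (((∫ s in t..(t + δ), Real.exp (A s - A δ)) - δ * Real.exp (A t)) -
        ((∫ s in (0 : ℝ)..δ, Real.exp (A s - A δ)) - δ) +
        ((Real.exp (-A δ) - 1 + A δ) * G - (A δ - δ * x₀) * G)) / δ := by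
    field_simp
    ring
  rw [h7, abs_div, abs_of_pos hδ, div_le_iff₀ hδ]
  have h8 : |(Real.exp (-A δ) - 1 + A δ) * G| ≤ (M * δ) ^ 2 * (E * t) := by
    rw [abs_mul, abs_of_nonneg hG0]; gcongr
  have h9 : |(A δ - δ * x₀) * G| ≤ δ * |A δ / δ - x₀| * (E * t) := by
    rw [abs_mul, abs_of_nonneg hG0, h6]; gcongr
  refine (abs_add_le _ _).trans ((add_le_add (abs_sub _ _) (abs_sub _ _)).trans
    ((add_le_add (add_le_add h4 h3) (add_le_add h8 h9)).trans (le_of_eq ?_)))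
  ring

end Path

/-! ### Exponential moments of time integrals are determined by finite-dimensional moments -/

section Moments

variable {S : Type*} [MeasurableSpace S] {Pr : Measure S} [IsProbabilityMeasure Pr]
  {X Y : ℝ → S → ℝ} {W W' : S → ℝ}

theorem measurable_intervalIntegral (hX : Measurable (Function.uncurry X)) (a b : ℝ) :
    Measurable fun w => ∫ s in a..b, X s w := by
  simp only [intervalIntegral]
  exact (hX.stronglyMeasurable.integral_prod_left' (μ := volume.restrict (Set.Ioc a b))).measurable.sub
    (hX.stronglyMeasurable.integral_prod_left' (μ := volume.restrict (Set.Ioc b a))).measurable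

theorem bddMeasurable_intervalIntegral (hX : BddMeasurable (Function.uncurry X)) (a b : ℝ) :
    BddMeasurable fun w => ∫ s in a..b, X s w := by
  obtain ⟨hm, C, hC⟩ := hX
  exact ⟨measurable_intervalIntegral hm a b, C * |b - a|, fun w =>
    intervalIntegral.norm_integral_le_of_norm_le_const (f := fun s => X s w)
      fun s _ => hC (s, w)⟩

theorem integral_mul_intervalIntegral (hW : BddMeasurable W)
    (hX : BddMeasurable (Function.uncurry X)) {t : ℝ} (ht : 0 ≤ t) :
    ∫ w, W w * (∫ s in (0 : ℝ)..t, X s w) ∂Pr = ∫ s in (0 : ℝ)..t, ∫ w, W w * X s w ∂Pr := by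
  simp only [intervalIntegral.integral_of_le ht, ← integral_const_mul]
  refine integral_integral_swap (f := fun w s => W w * X s w) ?_
  exact ((hW.comp measurable_fst).mul (hX.comp measurable_swap)).integrable

theorem integral_mul_pow_intervalIntegral (hW : BddMeasurable W)
    (hX : BddMeasurable (Function.uncurry X)) {t : ℝ} (ht : 0 ≤ t) (n : ℕ) :
    ∫ w, W w * (∫ s in (0 : ℝ)..t, X s w) ^ n ∂Pr =
      ∫ r : Fin n → ℝ, (∫ w, W w * ∏ i, X (r i) w ∂Pr)
        ∂Measure.pi fun _ => volume.restrict (Set.Ioc 0 t) := by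
  have h1 : ∀ w, (∫ s in (0 : ℝ)..t, X s w) ^ n = ∫ r : Fin n → ℝ, ∏ i, X (r i) w
      ∂Measure.pi fun _ => volume.restrict (Set.Ioc 0 t) := fun w => by
    rw [integral_fintype_prod_eq_pow fun s => X s w, Fintype.card_fin,
      intervalIntegral.integral_of_le ht]
  simp only [h1, ← integral_const_mul]
  refine integral_integral_swap (f := fun w (r : Fin n → ℝ) => W w * ∏ i, X (r i) w) ?_
  obtain ⟨hm, C, hC⟩ := hX
  refine ((hW.comp measurable_fst).mul (h := fun p : S × (Fin n → ℝ) => ∏ i, X (p.2 i) p.1)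
    ⟨?_, C ^ n, fun p => ?_⟩).integrable
  · refine Finset.measurable_fun_prod _ fun i _ => ?_
    exact hm.comp (g := Function.uncurry X) (f := fun p : S × (Fin n → ℝ) => (p.2 i, p.1))
      (((measurable_pi_apply i).comp measurable_snd).prodMk measurable_fst)
  · rw [Finset.abs_prod]
    exact (Finset.prod_le_prod (fun _ _ => abs_nonneg _) fun i _ => hC (p.2 i, p.1)).trans
      (by simp)

theorem hasSum_integral_mul_exp (hW : BddMeasurable W) {F : S → ℝ} (hF : BddMeasurable F) :
    HasSum (fun n : ℕ => (∫ w, W w * F w ^ n ∂Pr) / n.factorial)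
      (∫ w, W w * Real.exp (F w) ∂Pr) := by
  have hint : ∀ n : ℕ, BddMeasurable fun w => W w * F w ^ n / n.factorial := fun n => by
    simpa only [div_eq_inv_mul] using (hW.mul (hF.pow n)).const_mul _
  obtain ⟨C, hC⟩ := hF.2
  obtain ⟨D, hD⟩ := hW.2
  have h1 := hasSum_integral_of_summable_integral_norm (μ := Pr)
    (F := fun (n : ℕ) w => W w * F w ^ n / n.factorial) (fun n => (hint n).integrable) (by
      refine Summable.of_nonneg_of_le (fun n => integral_nonneg fun w => norm_nonneg _)
        (fun n => ?_) ((Real.summable_pow_div_factorial C).mul_left D)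
      have h2 : ∀ w, ‖W w * F w ^ n / n.factorial‖ ≤ D * (C ^ n / n.factorial) := fun w => by
        rw [norm_div, norm_mul, norm_pow, Real.norm_natCast, mul_div_assoc]
        exact mul_le_mul (hD w)
          (div_le_div_of_nonneg_right (pow_le_pow_left₀ (norm_nonneg _) (hC w) n)
            (Nat.cast_nonneg _)) (by positivity) ((abs_nonneg _).trans (hD w))
      exact (integral_mono (hint n).integrable.norm (integrable_const _) h2).trans (by simp))
  have h2 : ∀ w, ∑' n : ℕ, W w * F w ^ n / n.factorial = W w * Real.exp (F w) := fun w => by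
    simp only [mul_div_assoc]
    rw [tsum_mul_left, Real.exp_eq_exp_ℝ, (NormedSpace.expSeries_div_hasSum_exp (F w)).tsum_eq]
  simpa only [h2, integral_div] using h1

/-- If all weighted moments of `X` and `Y` at finitely many times agree, so do the weighted
exponential moments of their time integrals. -/
theorem integral_mul_exp_eq_of_moments (hW : BddMeasurable W) (hW' : BddMeasurable W')
    (hX : BddMeasurable (Function.uncurry X)) (hY : BddMeasurable (Function.uncurry Y))
    {t : ℝ} (ht : 0 ≤ t)
    (h : ∀ (n : ℕ) (r : Fin n → ℝ),
      ∫ w, W w * ∏ i, X (r i) w ∂Pr = ∫ w, W' w * ∏ i, Y (r i) w ∂Pr) :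
    ∫ w, W w * Real.exp (∫ s in (0 : ℝ)..t, X s w) ∂Pr =
      ∫ w, W' w * Real.exp (∫ s in (0 : ℝ)..t, Y s w) ∂Pr := by
  have h1 := hasSum_integral_mul_exp (Pr := Pr) hW (bddMeasurable_intervalIntegral hX 0 t)
  have h2 := hasSum_integral_mul_exp (Pr := Pr) hW' (bddMeasurable_intervalIntegral hY 0 t)
  simp only [integral_mul_pow_intervalIntegral hW hX ht, h] at h1
  simp only [integral_mul_pow_intervalIntegral hW' hY ht] at h2
  exact h1.unique h2

end Moments

/-! ### The exponential functional of the path and its shifts -/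

/-- The functional `∫_0^t exp (∫_0^s f(Z_r) dr) ds` of the path. Its conditional expectation given
`Z_0` is `∫_0^t Q_s 1 ds`, where `Q` is the Feynman-Kac semigroup with potential `f`. -/
noncomputable def expFunctional {Ω S : Type*} (f : Ω → ℝ) (Z : ℝ≥0 → S → Ω) (t : ℝ) (w : S) : ℝ :=
  ∫ s in (0 : ℝ)..t, Real.exp (pathIntegral f Z s w)

theorem expFunctional_eq_indicator {Ω S : Type*} {f : Ω → ℝ} {Z : ℝ≥0 → S → Ω} {t : ℝ}
    (ht : 0 ≤ t) (w : S) :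
    expFunctional f Z t w =
      ∫ s in (0 : ℝ)..t, (Set.Ioc 0 t).indicator (fun s => Real.exp (pathIntegral f Z s w)) s := by
  rw [expFunctional, intervalIntegral.integral_of_le ht, intervalIntegral.integral_of_le ht,
    setIntegral_indicator measurableSet_Ioc, Set.inter_self]

theorem expFunctional_nonneg {Ω S : Type*} {f : Ω → ℝ} {Z : ℝ≥0 → S → Ω} {t : ℝ}
    (ht : 0 ≤ t) (w : S) : 0 ≤ expFunctional f Z t w :=
  intervalIntegral.integral_nonneg ht fun _ _ => (Real.exp_pos _).le

section Functional

variable {Ω S : Type*} [MeasurableSpace Ω] [MeasurableSpace S] {f : Ω → ℝ} {Z : ℝ≥0 → S → Ω}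
  {M : ℝ}

theorem bddMeasurable_path (hf : BddMeasurable f)
    (hZ : Measurable fun p : ℝ≥0 × S => Z p.1 p.2) :
    BddMeasurable (Function.uncurry fun (s : ℝ) w => f (Z s.toNNReal w)) :=
  hf.comp (φ := fun p : ℝ × S => Z p.1.toNNReal p.2)
    (hZ.comp ((measurable_real_toNNReal.comp measurable_fst).prodMk measurable_snd))

theorem measurable_shift (hZ : Measurable fun p : ℝ≥0 × S => Z p.1 p.2) (d : ℝ≥0) :
    Measurable fun p : ℝ≥0 × S => Z (d + p.1) p.2 :=
  hZ.comp ((measurable_const.add measurable_fst).prodMk measurable_snd)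

theorem bddMeasurable_pathIntegral (hf : BddMeasurable f)
    (hZ : Measurable fun p : ℝ≥0 × S => Z p.1 p.2) (t : ℝ) :
    BddMeasurable (pathIntegral f Z t) :=
  bddMeasurable_intervalIntegral (bddMeasurable_path hf hZ) 0 t

theorem measurable_eval_path (hf : Measurable f)
    (hZ : Measurable fun p : ℝ≥0 × S => Z p.1 p.2) (w : S) :
    Measurable fun s : ℝ => f (Z s.toNNReal w) :=
  hf.comp (hZ.comp (measurable_real_toNNReal.prodMk measurable_const))

theorem continuous_pathIntegral (hf : Measurable f) (hM : ∀ z, |f z| ≤ M)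
    (hZ : Measurable fun p : ℝ≥0 × S => Z p.1 p.2) (w : S) :
    Continuous fun t => pathIntegral f Z t w :=
  continuous_integral_path (measurable_eval_path hf hZ w) fun _ => hM _

theorem abs_pathIntegral_le (hf : Measurable f) (hM : ∀ z, |f z| ≤ M)
    (hZ : Measurable fun p : ℝ≥0 × S => Z p.1 p.2) (t : ℝ) (w : S) :
    |pathIntegral f Z t w| ≤ M * |t| :=
  abs_integral_le (measurable_eval_path hf hZ w) (fun _ => hM _) t

theorem bddMeasurable_exp_pathIntegral (hf : BddMeasurable f)
    (hZ : Measurable fun p : ℝ≥0 × S => Z p.1 p.2) (t : ℝ) :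
    BddMeasurable fun w => Real.exp (pathIntegral f Z t w) := by
  obtain ⟨hm, C, hC⟩ := bddMeasurable_pathIntegral hf hZ t
  refine ⟨hm.exp, Real.exp C, fun w => ?_⟩
  rw [Real.abs_exp]
  exact Real.exp_le_exp.2 ((le_abs_self _).trans (hC w))

/-- The integrand of `expFunctional`, cut off outside `[0, t]` so as to be bounded. -/
theorem bddMeasurable_uncurry_exp_pathIntegral (hf : BddMeasurable f)
    (hZ : Measurable fun p : ℝ≥0 × S => Z p.1 p.2) (t : ℝ) :
    BddMeasurable (Function.uncurry fun (s : ℝ) w =>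
      (Set.Ioc 0 t).indicator (fun s => Real.exp (pathIntegral f Z s w)) s) := by
  obtain ⟨hf, M, hM⟩ := id hf
  have h1 : Measurable (Function.uncurry fun (s : ℝ) w => pathIntegral f Z s w) :=
    measurable_uncurry_of_continuous_of_measurable
      (fun w => continuous_pathIntegral hf hM hZ w)
      fun s => (bddMeasurable_pathIntegral ⟨hf, M, hM⟩ hZ s).1
  refine ⟨?_, Real.exp (M * t), fun p => ?_⟩
  · have h2 : (Function.uncurry fun (s : ℝ) w =>
        (Set.Ioc 0 t).indicator (fun s => Real.exp (pathIntegral f Z s w)) s) =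
        (Prod.fst ⁻¹' Set.Ioc 0 t).indicator
          (fun p : ℝ × S => Real.exp (Function.uncurry (pathIntegral f Z) p)) := by
      ext p
      rfl
    rw [h2]
    exact h1.exp.indicator (measurable_fst measurableSet_Ioc)
  · by_cases hp : p.1 ∈ Set.Ioc 0 t
    · have hM0 : 0 ≤ M := (abs_nonneg _).trans (hM (Z 0 p.2))
      simp only [Function.uncurry, Set.indicator_of_mem hp, Real.abs_exp, Real.exp_le_exp]
      refine (le_abs_self _).trans ((abs_pathIntegral_le hf hM hZ _ _).trans ?_)
      rw [abs_of_pos hp.1]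
      exact mul_le_mul_of_nonneg_left hp.2 hM0
    · simp only [Function.uncurry, Set.indicator_of_notMem hp, abs_zero]
      exact (Real.exp_pos _).le

theorem bddMeasurable_expFunctional (hf : BddMeasurable f)
    (hZ : Measurable fun p : ℝ≥0 × S => Z p.1 p.2) {t : ℝ} (ht : 0 ≤ t) :
    BddMeasurable (expFunctional f Z t) := by
  rw [funext (expFunctional_eq_indicator ht)]
  exact bddMeasurable_intervalIntegral (bddMeasurable_uncurry_exp_pathIntegral hf hZ t) 0 t

theorem integral_mul_expFunctional {Pr : Measure S} [IsProbabilityMeasure Pr]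
    (hf : BddMeasurable f) (hZ : Measurable fun p : ℝ≥0 × S => Z p.1 p.2)
    {W : S → ℝ} (hW : BddMeasurable W) {t : ℝ} (ht : 0 ≤ t) :
    ∫ w, W w * expFunctional f Z t w ∂Pr =
      ∫ s in (0 : ℝ)..t, ∫ w, W w * Real.exp (pathIntegral f Z s w) ∂Pr := by
  simp only [expFunctional_eq_indicator ht]
  rw [integral_mul_intervalIntegral hW (bddMeasurable_uncurry_exp_pathIntegral hf hZ t) ht]
  apply intervalIntegral.integral_congr_ae
  refine Eventually.of_forall fun s hs => ?_
  rw [Set.uIoc_of_le ht] at hs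
  simp only [Set.indicator_of_mem hs]

end Functional

namespace MarkovSemigroup.Governs

variable {Ω S : Type*} [MeasurableSpace Ω] [MeasurableSpace S] {P : MarkovSemigroup Ω}
  {μ : Measure Ω} {Pr : Measure S} [IsProbabilityMeasure Pr] {Z : ℝ≥0 → S → Ω} {f : Ω → ℝ}

theorem integral_mul_exp_pathIntegral_eq (hZ : P.Governs μ Pr Z)
    (hf : BddMeasurable f) {d : ℝ≥0} {W W' : S → ℝ} (hW : @BddMeasurable S (past Z d) W)
    (hW' : @BddMeasurable S (past Z 0) W')
    (h : ∀ k : Ω → ℝ, BddMeasurable k →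
      ∫ w, W w * k (Z d w) ∂Pr = ∫ w, W' w * k (Z 0 w) ∂Pr) {t : ℝ} (ht : 0 ≤ t) :
    ∫ w, W w * Real.exp (pathIntegral f (fun r => Z (d + r)) t w) ∂Pr =
      ∫ w, W' w * Real.exp (pathIntegral f Z t w) ∂Pr :=
  integral_mul_exp_eq_of_moments (hW.mono (hZ.past_le d)) (hW'.mono (hZ.past_le 0))
    (bddMeasurable_path (Z := fun r => Z (d + r)) hf (measurable_shift hZ.measurable d))
    (bddMeasurable_path hf hZ.measurable) ht
    fun _ r => hZ.integral_mul_prod_eq hf hW hW' h fun i => (r i).toNNReal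

/-- Two weights, one at time `d` and one at time `0`, that agree on functions of the present state
also agree on the exponential functional of the future path. -/
theorem integral_mul_expFunctional_eq (hZ : P.Governs μ Pr Z)
    (hf : BddMeasurable f) {d : ℝ≥0} {W W' : S → ℝ} (hW : @BddMeasurable S (past Z d) W)
    (hW' : @BddMeasurable S (past Z 0) W')
    (h : ∀ k : Ω → ℝ, BddMeasurable k →
      ∫ w, W w * k (Z d w) ∂Pr = ∫ w, W' w * k (Z 0 w) ∂Pr) {t : ℝ} (ht : 0 ≤ t) :
    ∫ w, W w * expFunctional f (fun r => Z (d + r)) t w ∂Pr =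
      ∫ w, W' w * expFunctional f Z t w ∂Pr := by
  rw [integral_mul_expFunctional hf (measurable_shift hZ.measurable d)
      (hW.mono (hZ.past_le d)) ht,
    integral_mul_expFunctional hf hZ.measurable (hW'.mono (hZ.past_le 0)) ht]
  refine intervalIntegral.integral_congr fun s hs => ?_
  rw [Set.uIcc_of_le ht] at hs
  exact hZ.integral_mul_exp_pathIntegral_eq hf hW hW' h hs.1

end MarkovSemigroup.Governs

/-! ### Conditional expectations given the state at one time -/

section CondExp

variable {Ω S : Type*} [MeasurableSpace Ω] [mS : MeasurableSpace S] {Pr : Measure S}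
  {φ : S → Ω} {H : S → ℝ}

/-- A conditional expectation `E[H | φ]` of a bounded variable is a bounded function of `φ`. -/
theorem exists_bddMeasurable_condExp (hH : BddMeasurable H) :
    ∃ U : Ω → ℝ, BddMeasurable U ∧
      (fun w => U (φ w)) =ᵐ[Pr] Pr[H | MeasurableSpace.comap φ inferInstance] := by
  obtain ⟨hm, C, hC⟩ := hH
  obtain ⟨u, hu, hu'⟩ := (stronglyMeasurable_condExp (f := H) (μ := Pr)
    (m := MeasurableSpace.comap φ inferInstance)).exists_eq_measurable_comp
  have hb : ∀ᵐ w ∂Pr, |(Pr[H | MeasurableSpace.comap φ inferInstance]) w| ≤ C :=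
    ae_bdd_abs_condExp_of_ae_bdd_abs (Eventually.of_forall hC)
  refine ⟨fun z => max (-|C|) (min |C| (u z)),
    ⟨measurable_const.max (measurable_const.min hu.measurable), |C|, fun z => ?_⟩, ?_⟩
  · exact abs_le.2 ⟨le_max_left _ _, max_le (by linarith [abs_nonneg C]) (min_le_left _ _)⟩
  · filter_upwards [hb] with w hw
    rw [hu'] at hw ⊢
    have h1 := abs_le.1 (hw.trans (le_abs_self C))
    simp only [Function.comp_apply] at h1 ⊢
    rw [min_eq_right h1.2, max_eq_right h1.1]

variable [IsProbabilityMeasure Pr]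

theorem integral_mul_condExp (hφ : Measurable φ) (hH : BddMeasurable H) {U : Ω → ℝ}
    (hU : (fun w => U (φ w)) =ᵐ[Pr] Pr[H | MeasurableSpace.comap φ inferInstance])
    {k : Ω → ℝ} (hk : BddMeasurable k) :
    ∫ w, k (φ w) * U (φ w) ∂Pr = ∫ w, k (φ w) * H w ∂Pr := by
  obtain ⟨C, hC⟩ := hk.2
  have h1 := condExp_stronglyMeasurable_mul_of_bound hφ.comap_le (μ := Pr)
    (f := fun w => k (φ w)) (g := H) (hk.1.comp (comap_measurable φ)).stronglyMeasurable
    hH.integrable C (Eventually.of_forall fun w => hC _)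
  calc ∫ w, k (φ w) * U (φ w) ∂Pr
      = ∫ w, (Pr[(fun w => k (φ w)) * H | MeasurableSpace.comap φ inferInstance]) w ∂Pr := by
        apply integral_congr_ae
        filter_upwards [h1, hU] with w hw1 hw2
        rw [hw1, Pi.mul_apply, hw2]
    _ = ∫ w, k (φ w) * H w ∂Pr := integral_condExp hφ.comap_le

theorem ae_eq_condExp_of_integral_mul (hφ : Measurable φ) (hH : BddMeasurable H) {V : Ω → ℝ}
    (hV : BddMeasurable V)
    (h : ∀ k : Ω → ℝ, BddMeasurable k →
      ∫ w, k (φ w) * V (φ w) ∂Pr = ∫ w, k (φ w) * H w ∂Pr) :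
    (fun w => V (φ w)) =ᵐ[Pr] Pr[H | MeasurableSpace.comap φ inferInstance] := by
  refine ae_eq_condExp_of_forall_setIntegral_eq hφ.comap_le hH.integrable
    (fun s _ _ => (hV.comp hφ).integrable.integrableOn) ?_
    (hV.1.comp (comap_measurable φ)).aestronglyMeasurable
  rintro s ⟨B, hB, rfl⟩ -
  have h1 := h (B.indicator 1) ⟨measurable_one.indicator hB, 1, fun z => by
    by_cases hz : z ∈ B <;> simp [hz]⟩
  have h2 : ∀ (F : S → ℝ) w, B.indicator (1 : Ω → ℝ) (φ w) * F w = (φ ⁻¹' B).indicator F w :=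
    fun F w => by by_cases hw : φ w ∈ B <;> simp [hw]
  simp only [h2 fun w => V (φ w), h2 H] at h1
  rwa [integral_indicator (hφ hB), integral_indicator (hφ hB)] at h1

end CondExp

namespace MarkovSemigroup.Governs

variable {Ω S : Type*} [MeasurableSpace Ω] [mS : MeasurableSpace S] {P : MarkovSemigroup Ω}
  {μ : Measure Ω} [IsProbabilityMeasure μ] {Pr : Measure S} [IsProbabilityMeasure Pr]
  {Z : ℝ≥0 → S → Ω} {f : Ω → ℝ}

/-- If `U(Z_0)` is the conditional expectation of the exponential functional of the path given
`Z_0`, then `(P_d U)(Z_0)` is that of the functional of the path shifted by `d`. -/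
theorem act_ae_eq_condExp_shift (hZ : P.Governs μ Pr Z) (hμ : P.IsStationary μ)
    (hf : BddMeasurable f) {t : ℝ} (ht : 0 ≤ t) {U : Ω → ℝ} (hU : BddMeasurable U)
    (hU' : (fun w => U (Z 0 w)) =ᵐ[Pr]
      Pr[expFunctional f Z t | MeasurableSpace.comap (Z 0) inferInstance]) (d : ℝ≥0) :
    (fun w => P.act d U (Z 0 w)) =ᵐ[Pr]
      Pr[expFunctional f (fun r => Z (d + r)) t |
        MeasurableSpace.comap (Z 0) inferInstance] := by
  have h0 := hZ.measurable_eval 0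
  have hd := hZ.measurable_eval d
  refine ae_eq_condExp_of_integral_mul h0
    (bddMeasurable_expFunctional hf (measurable_shift hZ.measurable d) ht)
    (bddMeasurable_act P d hU) fun k hk => ?_
  -- `k'` represents the adjoint of `P_d` applied to `k`: it is `E[k(Z_0) | Z_d]`.
  obtain ⟨k', hk', hkk'⟩ := exists_bddMeasurable_condExp (Pr := Pr) (φ := Z d) (hk.comp h0)
  have hadj : ∀ h : Ω → ℝ, BddMeasurable h →
      ∫ w, k (Z 0 w) * h (Z d w) ∂Pr = ∫ w, k' (Z 0 w) * h (Z 0 w) ∂Pr := fun h hh => by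
    have h1 := integral_mul_condExp hd (hk.comp h0) hkk' hh
    simp only [mul_comm (h _)] at h1
    rw [← h1, hZ.integral_eval hμ d (hk'.mul hh), hZ.integral_eval hμ 0 (hk'.mul hh)]
  have hk0 : @BddMeasurable S (past Z 0) fun w => k (Z 0 w) :=
    hk.comp (measurable_past Z le_rfl)
  have hk0' : @BddMeasurable S (past Z 0) fun w => k' (Z 0 w) :=
    hk'.comp (measurable_past Z le_rfl)
  have h1 := hZ.integral_mul_act (t := d) hk0 hU
  rw [zero_add] at h1
  rw [← h1, hadj U hU,
    integral_mul_condExp h0 (bddMeasurable_expFunctional hf hZ.measurable ht) hU' hk',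
    hZ.integral_mul_expFunctional_eq hf (hk0.mono (past_mono Z zero_le)) hk0' hadj ht]

end MarkovSemigroup.Governs

/-! ### Mean-square continuity of the stationary process -/

theorem sq_intervalIntegral_le {x : ℝ → ℝ} (hx : BddMeasurable x) {δ : ℝ} (hδ : 0 < δ) :
    (∫ s in (0 : ℝ)..δ, x s) ^ 2 ≤ δ * ∫ s in (0 : ℝ)..δ, x s ^ 2 := by
  set c := (∫ s in (0 : ℝ)..δ, x s) / δ with hc
  have h1 : 0 ≤ ∫ s in (0 : ℝ)..δ, (x s - c) ^ 2 :=
    intervalIntegral.integral_nonneg hδ.le fun _ _ => sq_nonneg _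
  have h2 : ∫ s in (0 : ℝ)..δ, (x s - c) ^ 2 =
      (∫ s in (0 : ℝ)..δ, x s ^ 2) - 2 * c * (∫ s in (0 : ℝ)..δ, x s) + δ * c ^ 2 := by
    have h3 : ∀ s, (x s - c) ^ 2 = x s ^ 2 - 2 * c * x s + c ^ 2 := fun s => by ring
    simp only [h3]
    rw [intervalIntegral.integral_add, intervalIntegral.integral_sub,
      intervalIntegral.integral_const_mul]
    · simp
    · exact (hx.pow 2).intervalIntegrable 0 δ
    · exact (hx.const_mul (2 * c)).intervalIntegrable 0 δ
    · exact ((hx.pow 2).sub (hx.const_mul (2 * c))).intervalIntegrable 0 δ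
    · exact intervalIntegrable_const
  have h4 : ∫ s in (0 : ℝ)..δ, x s = δ * c := by rw [hc]; field_simp
  rw [h2, h4] at h1
  rw [h4]
  nlinarith

namespace MarkovSemigroup.Governs

variable {Ω S : Type*} [MeasurableSpace Ω] [mS : MeasurableSpace S] {P : MarkovSemigroup Ω}
  {μ : Measure Ω} [IsProbabilityMeasure μ] {Pr : Measure S} [IsProbabilityMeasure Pr]
  {Z : ℝ≥0 → S → Ω} {f : Ω → ℝ}

/-- Stationarity of the correlations between the process and its future time integrals. -/
theorem integral_eval_mul_pathIntegral (hZ : P.Governs μ Pr Z) (hμ : P.IsStationary μ)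
    (hf : BddMeasurable f) (r : ℝ≥0) {δ : ℝ} (hδ : 0 ≤ δ) :
    ∫ w, f (Z r w) * pathIntegral f (fun s => Z (r + s)) δ w ∂Pr =
      ∫ s in (0 : ℝ)..δ, ∫ z, f z * P.act s.toNNReal f z ∂μ := by
  unfold pathIntegral
  rw [integral_mul_intervalIntegral (X := fun s w => f (Z (r + s.toNNReal) w))
    (hf.comp (hZ.measurable_eval r))
    (bddMeasurable_path (Z := fun s => Z (r + s)) hf (measurable_shift hZ.measurable r)) hδ]
  refine intervalIntegral.integral_congr fun s _ => ?_
  have h1 := hZ.integral_mul_act (s := r) (t := s.toNNReal) (W := fun w => f (Z r w))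
    (hf.comp (measurable_past Z le_rfl)) hf
  exact h1.trans (hZ.integral_eval hμ r (hf.mul (bddMeasurable_act P _ hf)))

theorem pathIntegral_shift (hZ : Measurable fun p : ℝ≥0 × S => Z p.1 p.2) (hf : BddMeasurable f)
    {r δ : ℝ} (hr : 0 ≤ r) (hδ : 0 ≤ δ) (w : S) :
    pathIntegral f (fun s => Z (r.toNNReal + s)) δ w =
      pathIntegral f Z (r + δ) w - pathIntegral f Z r w := by
  have hx : BddMeasurable fun s : ℝ => f (Z s.toNNReal w) :=
    ⟨measurable_eval_path hf.1 hZ w, hf.2.choose, fun _ => hf.2.choose_spec _⟩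
  rw [pathIntegral, pathIntegral, pathIntegral, intervalIntegral.integral_interval_sub_left
    (hx.intervalIntegrable _ _) (hx.intervalIntegrable _ _)]
  have h1 := intervalIntegral.integral_comp_add_left (a := 0) (b := δ)
    (fun s : ℝ => f (Z s.toNNReal w)) r
  rw [add_zero] at h1
  rw [← h1]
  refine intervalIntegral.integral_congr fun s hs => ?_
  rw [Set.uIcc_of_le hδ] at hs
  simp only [Real.toNNReal_add hr hs.1]

/-- By stationarity `E[f(Z_0) A_δ] / δ`, where `A_δ = ∫_0^δ f(Z_s) ds`, may be averaged over
starting times in `[0, 1]`. Lebesgue's differentiation theorem along each path then gives the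
limit: joint measurability is the only regularity of the process that is needed. -/
theorem tendsto_integral_eval_mul_average (hZ : P.Governs μ Pr Z) (hμ : P.IsStationary μ)
    (hf : BddMeasurable f) :
    Tendsto (fun δ : ℝ => ∫ w, f (Z 0 w) * (pathIntegral f Z δ w / δ) ∂Pr) (𝓝[>] 0)
      (𝓝 (∫ z, f z ^ 2 ∂μ)) := by
  obtain ⟨hfm, M, hM⟩ := id hf
  have hM' : ∀ s : ℝ, ∀ w, |f (Z s.toNNReal w)| ≤ M := fun s w => hM _
  let F : ℝ → ℝ → S → ℝ := fun δ r w => f (Z r.toNNReal w) *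
    ((pathIntegral f Z (r + δ) w - pathIntegral f Z r w) / δ)
  have hpath : ∀ w, Measurable fun s : ℝ => f (Z s.toNNReal w) :=
    measurable_eval_path hfm hZ.measurable
  have hA : Measurable (Function.uncurry fun (s : ℝ) w => pathIntegral f Z s w) :=
    measurable_uncurry_of_continuous_of_measurable
      (fun w => continuous_pathIntegral hfm hM hZ.measurable w)
      fun s => (bddMeasurable_pathIntegral hf hZ.measurable s).1
  have hFle : ∀ δ : ℝ, 0 < δ → ∀ r w, |F δ r w| ≤ M * M := fun δ hδ r w => by
    have h1 := abs_integral_sub_integral_le (hpath w) (fun _ => hM _) r (r + δ)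
    rw [add_sub_cancel_left, abs_of_pos hδ] at h1
    simp only [F, abs_mul, abs_div, abs_of_pos hδ]
    refine mul_le_mul (hM _) ((div_le_iff₀ hδ).2 h1) (by positivity)
      ((abs_nonneg _).trans (hM (Z 0 w)))
  have hFm : ∀ δ : ℝ, Measurable (Function.uncurry (F δ)) := fun δ =>
    (bddMeasurable_path hf hZ.measurable).1.mul
      (((hA.comp (g := Function.uncurry fun (s : ℝ) w => pathIntegral f Z s w)
        (f := fun p : ℝ × S => (p.1 + δ, p.2))
        ((measurable_fst.add_const δ).prodMk measurable_snd)).sub hA).div_const δ)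
  have hFb : ∀ δ : ℝ, 0 < δ → BddMeasurable (Function.uncurry (F δ)) := fun δ hδ =>
    ⟨hFm δ, M * M, fun p => hFle δ hδ p.1 p.2⟩
  -- pathwise convergence of the average over the starting time
  have hconv : ∀ w, Tendsto (fun δ => ∫ r in (0 : ℝ)..1, F δ r w) (𝓝[>] 0)
      (𝓝 (∫ r in (0 : ℝ)..1, f (Z r.toNNReal w) ^ 2)) := fun w => by
    refine intervalIntegral.tendsto_integral_filter_of_dominated_convergence (fun _ => M * M)
      (Eventually.of_forall fun δ => ((hFm δ).comp measurable_prodMk_right).aestronglyMeasurable)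
      (by
        filter_upwards [self_mem_nhdsWithin] with δ hδ
        exact Eventually.of_forall fun r _ => hFle δ hδ r w)
      intervalIntegrable_const ?_
    filter_upwards [LocallyIntegrable.ae_hasDerivAt_integral
      (BddMeasurable.locallyIntegrable (x := fun s : ℝ => f (Z s.toNNReal w))
        ⟨hpath w, M, fun _ => hM _⟩)] with r hr _
    have h1 := (hasDerivAt_iff_tendsto_slope_zero.1 (hr 0)).mono_left
      (nhdsWithin_mono 0 fun δ (hδ : 0 < δ) => hδ.ne')
    have h2 := h1.const_mul (f (Z r.toNNReal w))
    rw [← sq] at h2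
    refine h2.congr fun δ => ?_
    simp only [F, pathIntegral, smul_eq_mul]
    ring
  -- convergence of expectations
  have hconv' : Tendsto (fun δ => ∫ w, (∫ r in (0 : ℝ)..1, F δ r w) ∂Pr) (𝓝[>] 0)
      (𝓝 (∫ w, (∫ r in (0 : ℝ)..1, f (Z r.toNNReal w) ^ 2) ∂Pr)) := by
    refine tendsto_integral_filter_of_dominated_convergence (fun _ => M * M)
      (Eventually.of_forall fun δ =>
        (measurable_intervalIntegral (hFm δ) 0 1).aestronglyMeasurable) ?_
      (integrable_const _) (Eventually.of_forall hconv)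
    filter_upwards [self_mem_nhdsWithin] with δ hδ
    refine Eventually.of_forall fun w => ?_
    have h1 := intervalIntegral.norm_integral_le_of_norm_le_const (a := 0) (b := 1)
      (f := fun r => F δ r w) (C := M * M) fun r _ => hFle δ hδ r w
    simpa using h1
  have hlim : ∫ w, (∫ r in (0 : ℝ)..1, f (Z r.toNNReal w) ^ 2) ∂Pr = ∫ z, f z ^ 2 ∂μ := by
    have h1 := integral_mul_intervalIntegral (Pr := Pr) (BddMeasurable.const 1)
      ((bddMeasurable_path hf hZ.measurable).pow 2) zero_le_one
      (X := fun r w => f (Z r.toNNReal w) ^ 2)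
    simp only [one_mul] at h1
    rw [h1]
    simp only [fun r : ℝ => hZ.integral_eval hμ r.toNNReal (hf.pow 2)]
    simp
  rw [hlim] at hconv'
  refine hconv'.congr' ?_
  filter_upwards [self_mem_nhdsWithin] with δ hδ
  have hδ0 : (0 : ℝ) ≤ δ := le_of_lt hδ
  have h1 := integral_mul_intervalIntegral (Pr := Pr) (BddMeasurable.const 1) (hFb δ hδ)
    zero_le_one
  simp only [one_mul] at h1
  rw [h1]
  have h2 : ∀ r ∈ Set.uIcc (0 : ℝ) 1, ∫ w, F δ r w ∂Pr =
      ∫ w, f (Z 0 w) * (pathIntegral f Z δ w / δ) ∂Pr := fun r hr => by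
    rw [Set.uIcc_of_le zero_le_one] at hr
    simp only [F, ← pathIntegral_shift hZ.measurable hf hr.1 hδ0, ← mul_div_assoc,
      integral_div, hZ.integral_eval_mul_pathIntegral hμ hf _ hδ0]
    have h3 := hZ.integral_eval_mul_pathIntegral hμ hf 0 hδ0
    simp only [zero_add] at h3
    rw [h3]
  rw [intervalIntegral.integral_congr h2]
  simp

/-- The time average of `f(Z_s)` over `[0, δ]` tends to `f(Z_0)` in mean square as `δ → 0+`. -/
theorem tendsto_integral_sq_average_sub (hZ : P.Governs μ Pr Z) (hμ : P.IsStationary μ)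
    (hf : BddMeasurable f) :
    Tendsto (fun δ : ℝ => ∫ w, (pathIntegral f Z δ w / δ - f (Z 0 w)) ^ 2 ∂Pr) (𝓝[>] 0)
      (𝓝 0) := by
  have hlim := ((hZ.tendsto_integral_eval_mul_average hμ hf).const_sub
    (∫ z, f z ^ 2 ∂μ)).const_mul 2
  rw [sub_self, mul_zero] at hlim
  refine squeeze_zero' (Eventually.of_forall fun δ => integral_nonneg fun w => sq_nonneg _) ?_ hlim
  filter_upwards [self_mem_nhdsWithin] with δ hδ
  have hδ : 0 < δ := hδ
  have hf0 := hf.comp (hZ.measurable_eval 0)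
  have hA : BddMeasurable fun w => pathIntegral f Z δ w / δ := by
    simpa only [div_eq_inv_mul] using (bddMeasurable_pathIntegral hf hZ.measurable δ).const_mul _
  have h1 : ∀ w, (pathIntegral f Z δ w / δ - f (Z 0 w)) ^ 2 =
      (pathIntegral f Z δ w / δ) ^ 2 + f (Z 0 w) ^ 2 -
        2 * (f (Z 0 w) * (pathIntegral f Z δ w / δ)) := fun w => by ring
  have h2 : ∫ w, (pathIntegral f Z δ w / δ) ^ 2 ∂Pr ≤ ∫ z, f z ^ 2 ∂μ := by
    have h3 := integral_mul_intervalIntegral (Pr := Pr) (BddMeasurable.const δ⁻¹)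
      ((bddMeasurable_path hf hZ.measurable).pow 2) hδ.le
      (X := fun r w => f (Z r.toNNReal w) ^ 2)
    simp only [integral_const_mul, fun r : ℝ => hZ.integral_eval hμ r.toNNReal (hf.pow 2)] at h3
    rw [intervalIntegral.integral_const, sub_zero, smul_eq_mul, mul_left_comm,
      inv_mul_cancel_left₀ hδ.ne', ← integral_const_mul] at h3
    rw [← h3]
    refine integral_mono (hA.pow 2).integrable
      ((bddMeasurable_intervalIntegral (X := fun r w => f (Z r.toNNReal w) ^ 2)
        ((bddMeasurable_path hf hZ.measurable).pow 2) 0 δ).const_mul δ⁻¹).integrable fun w => ?_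
    have h4 := sq_intervalIntegral_le (x := fun s : ℝ => f (Z s.toNNReal w))
      ⟨measurable_eval_path hf.1 hZ.measurable w, hf.2.choose, fun _ => hf.2.choose_spec _⟩ hδ
    simp only [pathIntegral, div_pow]
    rw [div_le_iff₀ (by positivity)]
    refine h4.trans (le_of_eq ?_)
    field_simp
  simp only [h1]
  rw [integral_sub, integral_add, integral_const_mul, hZ.integral_eval hμ 0 (hf.pow 2)]
  · linarith
  · exact (hA.pow 2).integrable
  · exact (hf0.pow 2).integrable
  · exact (hA.pow 2).integrable.add (hf0.pow 2).integrable
  · exact ((hf0.mul hA).const_mul 2).integrable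

end MarkovSemigroup.Governs

/-! ### The exponential functional and the generator -/

/-- The variable whose conditional expectation given `Z_0` is the generator applied to the
conditional expectation of the exponential functional. -/
theorem bddMeasurable_generatorVariable {Ω S : Type*} [MeasurableSpace Ω] [MeasurableSpace S]
    {Z : ℝ≥0 → S → Ω} {f : Ω → ℝ} (hZ : Measurable fun p : ℝ≥0 × S => Z p.1 p.2)
    (hf : BddMeasurable f) {t : ℝ} (ht : 0 ≤ t) :
    BddMeasurable fun w =>
      Real.exp (pathIntegral f Z t w) - 1 - f (Z 0 w) * expFunctional f Z t w :=
  ((bddMeasurable_exp_pathIntegral hf hZ t).sub (.const 1)).sub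
    ((hf.comp (hZ.comp measurable_prodMk_left)).mul (bddMeasurable_expFunctional hf hZ ht))

namespace MarkovSemigroup

theorem HasGenerator.integral_eq_zero {Ω : Type*} [MeasurableSpace Ω] {P : MarkovSemigroup Ω}
    {μ : Measure Ω} [IsProbabilityMeasure μ] (hμ : P.IsStationary μ) {U g : Ω → ℝ}
    (hU : BddMeasurable U) (hg : BddMeasurable g) (h : P.HasGenerator μ U g) :
    ∫ z, g z ∂μ = 0 := by
  have h1 : ∀ t : ℝ≥0, ‖∫ z, g z ∂μ‖ₑ ≤
      eLpNorm (fun z => (P.act t U z - U z) / (t : ℝ) - g z) 2 μ := fun t => by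
    have hq : BddMeasurable fun z => (P.act t U z - U z) / (t : ℝ) := by
      simpa only [div_eq_inv_mul] using ((bddMeasurable_act P t hU).sub hU).const_mul _
    have h2 : ∫ z, ((P.act t U z - U z) / (t : ℝ) - g z) ∂μ = -∫ z, g z ∂μ := by
      rw [integral_sub hq.integrable hg.integrable, integral_div,
        integral_sub (bddMeasurable_act P t hU).integrable hU.integrable, integral_act hμ t hU,
        sub_self, zero_div, zero_sub]
    rw [← enorm_neg, ← h2]
    refine (enorm_integral_le_lintegral_enorm _).trans ?_
    rw [← eLpNorm_one_eq_lintegral_enorm]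
    exact eLpNorm_le_eLpNorm_of_exponent_le one_le_two (hq.sub hg).1.aestronglyMeasurable
  have h2 := ge_of_tendsto' h.2.2 h1
  simpa using h2

namespace Governs

variable {Ω S : Type*} [MeasurableSpace Ω] [mS : MeasurableSpace S] {P : MarkovSemigroup Ω}
  {μ : Measure Ω} [IsProbabilityMeasure μ] {Pr : Measure S} [IsProbabilityMeasure Pr]
  {Z : ℝ≥0 → S → Ω} {f : Ω → ℝ}

theorem tendsto_eLpNorm_average_sub (hZ : P.Governs μ Pr Z) (hμ : P.IsStationary μ)
    (hf : BddMeasurable f) :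
    Tendsto (fun δ : ℝ => eLpNorm (fun w => pathIntegral f Z δ w / δ - f (Z 0 w)) 2 Pr) (𝓝[>] 0)
      (𝓝 0) := by
  have h1 : ∀ δ : ℝ, eLpNorm (fun w => pathIntegral f Z δ w / δ - f (Z 0 w)) 2 Pr =
      ENNReal.ofReal (√(∫ w, (pathIntegral f Z δ w / δ - f (Z 0 w)) ^ 2 ∂Pr)) := fun δ => by
    have hA : BddMeasurable fun w => pathIntegral f Z δ w / δ := by
      simpa only [div_eq_inv_mul] using (bddMeasurable_pathIntegral hf hZ.measurable δ).const_mul _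
    have h2 := ((hA.sub (hf.comp (hZ.measurable_eval 0))).memLp (ν := Pr) 2)
    rw [h2.eLpNorm_eq_integral_rpow_norm two_ne_zero ENNReal.ofNat_ne_top, Real.sqrt_eq_rpow]
    simp
  simp only [h1]
  have h2 := ENNReal.tendsto_ofReal
    ((Real.continuous_sqrt.tendsto 0).comp (hZ.tendsto_integral_sq_average_sub hμ hf))
  simpa using h2

/-- The Feynman-Kac resolvent identity: if `U(Z_0) = E[∫_0^t e^{A_s} ds | Z_0]`, where
`A_s = ∫_0^s f(Z_r) dr`, then `U` is in the domain of the generator, and `(𝓛 U)(Z_0)` is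
`E[e^{A_t} - 1 | Z_0] - f(Z_0) U(Z_0)`. -/
theorem hasGenerator_of_ae_eq_condExp (hZ : P.Governs μ Pr Z) (hμ : P.IsStationary μ)
    (hf : BddMeasurable f) {t : ℝ} (ht : 0 ≤ t) {U g : Ω → ℝ}
    (hU : BddMeasurable U) (hg : BddMeasurable g)
    (hU' : (fun w => U (Z 0 w)) =ᵐ[Pr]
      Pr[expFunctional f Z t | MeasurableSpace.comap (Z 0) inferInstance])
    (hg' : (fun w => g (Z 0 w)) =ᵐ[Pr]
      Pr[fun w => Real.exp (pathIntegral f Z t w) - 1 - f (Z 0 w) * expFunctional f Z t w |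
        MeasurableSpace.comap (Z 0) inferInstance]) :
    P.HasGenerator μ U g := by
  refine ⟨hU.memLp 2, hg.memLp 2, ?_⟩
  obtain ⟨hfm, M, hM⟩ := id hf
  have h0 := hZ.measurable_eval 0
  have hG := bddMeasurable_expFunctional hf hZ.measurable ht
  set C₁ := Real.exp (M * (t + 2)) * (4 * M + t * M ^ 2)
  set C₂ := Real.exp (M * (t + 2)) * t
  -- conditional expectation is a contraction of `L²`, so the error may be computed pathwise
  have hbound : ∀ᶠ δ : ℝ≥0 in 𝓝[>] 0,
      eLpNorm (fun z => (P.act δ U z - U z) / (δ : ℝ) - g z) 2 μ ≤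
        ‖C₁ * (δ : ℝ)‖ₑ +
          ‖C₂‖ₑ * eLpNorm (fun w => pathIntegral f Z δ w / δ - f (Z 0 w)) 2 Pr := by
    have hsmall : ∀ᶠ δ : ℝ≥0 in 𝓝[>] 0, (δ : ℝ) < 1 ∧ M * (δ : ℝ) < 1 := by
      have hc : Continuous fun δ : ℝ≥0 => M * (δ : ℝ) := by fun_prop
      have h1 : ∀ᶠ δ : ℝ≥0 in 𝓝 0, (δ : ℝ) < 1 :=
        NNReal.continuous_coe.tendsto 0 |>.eventually_lt_const (by simp)
      have h2 : ∀ᶠ δ : ℝ≥0 in 𝓝 0, M * (δ : ℝ) < 1 :=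
        hc.tendsto 0 |>.eventually_lt_const (by simp)
      exact (h1.and h2).filter_mono nhdsWithin_le_nhds
    filter_upwards [hsmall, self_mem_nhdsWithin] with δ hδ hδ0
    have hδ0 : 0 < (δ : ℝ) := hδ0
    have hGs : BddMeasurable (expFunctional f (fun r => Z (δ + r)) t) :=
      bddMeasurable_expFunctional hf (measurable_shift hZ.measurable δ) ht
    have hD := bddMeasurable_generatorVariable hZ.measurable hf ht
    have hq : BddMeasurable fun z => (P.act δ U z - U z) / (δ : ℝ) := by
      simpa only [div_eq_inv_mul] using ((bddMeasurable_act P δ hU).sub hU).const_mul _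
    have h1 : eLpNorm (fun z => (P.act δ U z - U z) / (δ : ℝ) - g z) 2 μ =
        eLpNorm (fun w => (P.act δ U (Z 0 w) - U (Z 0 w)) / (δ : ℝ) - g (Z 0 w)) 2 Pr := by
      conv_lhs => rw [← hZ.initial]
      exact eLpNorm_map_measure (hq.sub hg).1.aestronglyMeasurable h0.aemeasurable
    set D : S → ℝ := fun w =>
      Real.exp (pathIntegral f Z t w) - 1 - f (Z 0 w) * expFunctional f Z t w
    set Gs := expFunctional f (fun r => Z (δ + r)) t
    have h2 : (fun w => (P.act δ U (Z 0 w) - U (Z 0 w)) / (δ : ℝ) - g (Z 0 w)) =ᵐ[Pr]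
        Pr[((δ : ℝ)⁻¹ • (Gs - expFunctional f Z t) - D) |
          MeasurableSpace.comap (Z 0) inferInstance] := by
      have e1 := condExp_sub (μ := Pr) hGs.integrable hG.integrable
        (MeasurableSpace.comap (Z 0) inferInstance)
      have e2 := condExp_smul (μ := Pr) (δ : ℝ)⁻¹ (Gs - expFunctional f Z t)
        (MeasurableSpace.comap (Z 0) inferInstance)
      have e3 := condExp_sub (μ := Pr) ((hGs.integrable.sub hG.integrable).smul (δ : ℝ)⁻¹)
        hD.integrable (MeasurableSpace.comap (Z 0) inferInstance)
      filter_upwards [e1, e2, e3, hU', hg', hZ.act_ae_eq_condExp_shift hμ hf ht hU hU' δ]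
        with w e1 e2 e3 e4 e5 e6
      rw [e3, Pi.sub_apply, e2, Pi.smul_apply, e1, Pi.sub_apply, ← e4, ← e5, ← e6, smul_eq_mul,
        div_eq_inv_mul]
    rw [h1, eLpNorm_congr_ae h2]
    refine (eLpNorm_condExp_le_eLpNorm _ one_le_two).trans ?_
    have h3 : ∀ w, ‖((δ : ℝ)⁻¹ • (Gs - expFunctional f Z t) - D) w‖ ≤
        ‖C₁ * (δ : ℝ)‖ + ‖C₂ * (pathIntegral f Z δ w / δ - f (Z 0 w))‖ := fun w => by
      have h4 := abs_shift_diffQuotient_le (measurable_eval_path hfm hZ.measurable w)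
        (fun _ => hM _) ht hδ0 hδ.1.le hδ.2.le (f (Z 0 w))
      have h5 : ((δ : ℝ)⁻¹ • (Gs - expFunctional f Z t) - D) w =
          ((∫ s in (0 : ℝ)..t, Real.exp (∫ r in (0 : ℝ)..s, f (Z ((δ : ℝ) + r).toNNReal w))) -
            ∫ s in (0 : ℝ)..t, Real.exp (∫ r in (0 : ℝ)..s, f (Z r.toNNReal w))) / δ - D w := by
        have h6 : Gs w = ∫ s in (0 : ℝ)..t,
            Real.exp (∫ r in (0 : ℝ)..s, f (Z ((δ : ℝ) + r).toNNReal w)) := by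
          refine intervalIntegral.integral_congr fun s hs => ?_
          rw [Set.uIcc_of_le ht] at hs
          simp only [pathIntegral]
          congr 1
          refine intervalIntegral.integral_congr fun r hr => ?_
          rw [Set.uIcc_of_le hs.1] at hr
          simp only [Real.toNNReal_add δ.coe_nonneg hr.1, Real.toNNReal_coe]
        rw [← h6, div_eq_inv_mul]
        rfl
      rw [h5, norm_mul C₂]
      exact h4.trans (add_le_add (le_abs_self _)
        (mul_le_mul_of_nonneg_right (le_abs_self _) (abs_nonneg _)))
    have hA : BddMeasurable fun w => pathIntegral f Z δ w / δ := by
      simpa only [div_eq_inv_mul] using (bddMeasurable_pathIntegral hf hZ.measurable δ).const_mul _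
    have hA' := (hA.sub (hf.comp h0)).1.aestronglyMeasurable (μ := Pr)
    calc eLpNorm ((δ : ℝ)⁻¹ • (Gs - expFunctional f Z t) - D) 2 Pr
        ≤ eLpNorm ((fun _ => ‖C₁ * (δ : ℝ)‖) +
            fun w => ‖C₂ * (pathIntegral f Z δ w / δ - f (Z 0 w))‖) 2 Pr :=
          eLpNorm_mono_real h3
      _ ≤ eLpNorm (fun _ => ‖C₁ * (δ : ℝ)‖) 2 Pr +
            eLpNorm (fun w => ‖C₂ * (pathIntegral f Z δ w / δ - f (Z 0 w))‖) 2 Pr :=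
          eLpNorm_add_le aestronglyMeasurable_const (hA'.const_mul C₂).norm one_le_two
      _ = _ := by
          have e1 : eLpNorm (fun w => ‖C₂ * (pathIntegral f Z δ w / δ - f (Z 0 w))‖) 2 Pr =
              eLpNorm (C₂ • fun w => pathIntegral f Z δ w / δ - f (Z 0 w)) 2 Pr :=
            eLpNorm_norm _
          rw [e1, eLpNorm_const_smul,
            eLpNorm_const _ two_ne_zero (IsProbabilityMeasure.ne_zero Pr)]
          simp
  have hlim : Tendsto (fun δ : ℝ≥0 => ‖C₁ * (δ : ℝ)‖ₑ +
      ‖C₂‖ₑ * eLpNorm (fun w => pathIntegral f Z δ w / δ - f (Z 0 w)) 2 Pr) (𝓝[>] 0) (𝓝 0) := by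
    have h1 : Tendsto (fun δ : ℝ≥0 => ‖C₁ * (δ : ℝ)‖ₑ) (𝓝[>] 0) (𝓝 0) := by
      have hc : Continuous fun δ : ℝ≥0 => ‖C₁ * (δ : ℝ)‖ₑ := by fun_prop
      simpa using (hc.tendsto 0).mono_left nhdsWithin_le_nhds
    have h2 : Tendsto (fun δ : ℝ≥0 => (δ : ℝ)) (𝓝[>] 0) (𝓝[>] 0) :=
      tendsto_nhdsWithin_of_tendsto_nhds_of_eventually_within _
        ((NNReal.continuous_coe.tendsto 0).mono_left nhdsWithin_le_nhds)
        (by filter_upwards [self_mem_nhdsWithin] with δ hδ using hδ)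
    have h3 := ENNReal.Tendsto.const_mul (a := ‖C₂‖ₑ)
      ((hZ.tendsto_eLpNorm_average_sub hμ hf).comp h2) (Or.inr enorm_ne_top)
    simpa using h1.add h3
  exact tendsto_of_tendsto_of_tendsto_of_le_of_le' tendsto_const_nhds hlim
    (Eventually.of_forall fun _ => zero_le) hbound

end Governs
end MarkovSemigroup

/-! ### The differential inequality and its integration -/

theorem integral_mul_le_sqrt_mul_sqrt {α : Type*} [MeasurableSpace α] {ν : Measure α}
    [IsFiniteMeasure ν] {p q : α → ℝ} (hp : BddMeasurable p) (hq : BddMeasurable q) :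
    ∫ x, p x * q x ∂ν ≤ √(∫ x, p x ^ 2 ∂ν) * √(∫ x, q x ^ 2 ∂ν) := by
  have h1 := integral_mul_norm_le_Lp_mul_Lq (μ := ν) (f := p) (g := q) (p := 2) (q := 2)
    Real.HolderConjugate.two_two (by simpa using hp.memLp 2) (by simpa using hq.memLp 2)
  have h2 : ∫ x, p x * q x ∂ν ≤ ∫ x, ‖p x‖ * ‖q x‖ ∂ν := by
    refine integral_mono (hp.mul hq).integrable ?_ fun x => ?_
    · simpa only [← norm_mul] using (hp.mul hq).integrable.norm
    · rw [← norm_mul]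
      exact le_abs_self _
  refine h2.trans (h1.trans (le_of_eq ?_))
  simp [Real.sqrt_eq_rpow]

/-- Grönwall's lemma in integrated form. -/
theorem le_exp_of_le_one_add_integral {a : ℝ → ℝ} (ha : Continuous a) {K : ℝ} (hK : 0 ≤ K)
    (h : ∀ t, 0 ≤ t → a t ≤ 1 + K * ∫ s in (0 : ℝ)..t, a s) {t : ℝ} (ht : 0 ≤ t) :
    a t ≤ Real.exp (K * t) := by
  set φ : ℝ → ℝ := fun t => Real.exp (-(K * t)) * (1 + K * ∫ s in (0 : ℝ)..t, a s) with hφ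
  have hd : ∀ t, HasDerivAt φ
      (Real.exp (-(K * t)) * (K * (a t - (1 + K * ∫ s in (0 : ℝ)..t, a s)))) t := fun t => by
    have h1 : HasDerivAt (fun t => ∫ s in (0 : ℝ)..t, a s) (a t) t :=
      intervalIntegral.integral_hasDerivAt_right (ha.intervalIntegrable _ _)
        ha.stronglyMeasurable.stronglyMeasurableAtFilter ha.continuousAt
    have h2 : HasDerivAt (fun t => Real.exp (-(K * t))) (Real.exp (-(K * t)) * -(K * 1)) t :=
      (((hasDerivAt_id t).const_mul K).neg).exp
    refine (h2.mul ((h1.const_mul K).const_add 1)).congr_deriv ?_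
    ring
  have hanti : AntitoneOn φ (Set.Ici 0) := by
    refine antitoneOn_of_deriv_nonpos (convex_Ici 0)
      (fun s _ => (hd s).continuousAt.continuousWithinAt)
      (fun s _ => (hd s).differentiableAt.differentiableWithinAt) fun s hs => ?_
    rw [interior_Ici] at hs
    rw [(hd s).deriv]
    exact mul_nonpos_of_nonneg_of_nonpos (Real.exp_pos _).le
      (mul_nonpos_of_nonneg_of_nonpos hK (sub_nonpos.2 (h s (le_of_lt hs))))
  have h1 := hanti (Set.mem_Ici.2 le_rfl) ht ht
  simp only [hφ, mul_zero, neg_zero, Real.exp_zero, intervalIntegral.integral_same, add_zero,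
    mul_one] at h1
  refine (h t ht).trans ?_
  rwa [Real.exp_neg, inv_mul_le_iff₀ (Real.exp_pos _), mul_one] at h1

theorem continuous_integral_exp_pathIntegral {Ω S : Type*} [MeasurableSpace Ω]
    [MeasurableSpace S] {f : Ω → ℝ} {Z : ℝ≥0 → S → Ω} {Pr : Measure S} [IsProbabilityMeasure Pr]
    (hf : BddMeasurable f) (hZ : Measurable fun p : ℝ≥0 × S => Z p.1 p.2) :
    Continuous fun t => ∫ w, Real.exp (pathIntegral f Z t w) ∂Pr := by
  obtain ⟨hfm, M, hM⟩ := id hf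
  refine continuous_iff_continuousAt.2 fun t => ?_
  refine continuousAt_of_dominated (bound := fun _ => Real.exp (|M| * (|t| + 1)))
    (Eventually.of_forall fun s =>
      (bddMeasurable_exp_pathIntegral hf hZ s).1.aestronglyMeasurable) ?_
    (integrable_const _) (Eventually.of_forall fun w =>
      (Real.continuous_exp.comp (continuous_pathIntegral hfm hM hZ w)).continuousAt)
  have h1 : ∀ᶠ s : ℝ in 𝓝 t, |s| < |t| + 1 :=
    (continuous_abs.tendsto t).eventually_lt_const (by linarith)
  filter_upwards [h1] with s hs
  refine Eventually.of_forall fun w => ?_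
  rw [Real.norm_eq_abs, Real.abs_exp, Real.exp_le_exp]
  refine (le_abs_self _).trans ((abs_pathIntegral_le hfm hM hZ s w).trans ?_)
  exact mul_le_mul (le_abs_self M) hs.le (abs_nonneg _) (abs_nonneg _)

namespace MarkovSemigroup.Governs

variable {Ω S : Type*} [MeasurableSpace Ω] [mS : MeasurableSpace S] {P : MarkovSemigroup Ω}
  {μ : Measure Ω} [IsProbabilityMeasure μ] {Pr : Measure S} [IsProbabilityMeasure Pr]
  {Z : ℝ≥0 → S → Ω} {f : Ω → ℝ} {η M σ : ℝ}

/-- The inequality `a' ≤ K a`, with `a(t) = E[exp (∫_0^t f(Z_s) ds)]`, in integrated form. -/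
theorem integral_exp_pathIntegral_le_one_add (hZ : P.Governs μ Pr Z) (hμ : P.IsStationary μ)
    (hη : 0 < η) (hIP : P.IteratedPoincare μ η) (hf : Measurable f) (hf_mean : ∫ z, f z ∂μ = 0)
    (hM : ∀ z, |f z| ≤ M) (hσ : 0 ≤ σ) (hf_var : variance f μ ≤ σ ^ 2)
    (hc : 0 < 1 - 4 * M ^ 2 / η ^ 2) {t : ℝ} (ht : 0 ≤ t) :
    ∫ w, Real.exp (pathIntegral f Z t w) ∂Pr ≤
      1 + 2 * σ * M / (√(1 - 4 * M ^ 2 / η ^ 2) * η) * ∫ w, expFunctional f Z t w ∂Pr := by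
  have hfb : BddMeasurable f := ⟨hf, M, hM⟩
  have h0 := hZ.measurable_eval 0
  have hG := bddMeasurable_expFunctional hfb hZ.measurable ht
  have hD := bddMeasurable_generatorVariable hZ.measurable hfb ht
  obtain ⟨U, hU, hU'⟩ := exists_bddMeasurable_condExp (Pr := Pr) (φ := Z 0) hG
  obtain ⟨g, hg, hg'⟩ := exists_bddMeasurable_condExp (Pr := Pr) (φ := Z 0) hD
  have hgen := hZ.hasGenerator_of_ae_eq_condExp hμ hfb ht hU hg hU' hg'
  have hM0 : 0 ≤ M := by
    obtain ⟨w⟩ : Nonempty S := nonempty_of_isProbabilityMeasure Pr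
    exact (abs_nonneg _).trans (hM (Z 0 w))
  set m := ∫ w, expFunctional f Z t w ∂Pr
  have hm0 : 0 ≤ m := integral_nonneg fun w => expFunctional_nonneg ht w
  have hUm : ∫ z, U z ∂μ = m := by
    have h1 := integral_mul_condExp h0 hG hU' (.const 1)
    simp only [one_mul] at h1
    rw [← hZ.integral_eval hμ 0 hU, h1]
  have hfU : ∫ z, f z * U z ∂μ = ∫ w, f (Z 0 w) * expFunctional f Z t w ∂Pr := by
    rw [← integral_mul_condExp h0 hG hU' hfb, hZ.integral_eval hμ 0 (hfb.mul hU)]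
  have hfG := (hfb.comp h0).mul hG
  have he := bddMeasurable_exp_pathIntegral hfb hZ.measurable t
  -- the mean of `𝓛 U` vanishes
  have hmean : ∫ w, Real.exp (pathIntegral f Z t w) ∂Pr = 1 + ∫ z, f z * U z ∂μ := by
    have h1 := hgen.integral_eq_zero hμ hU hg
    have h2 := integral_mul_condExp h0 hD hg' (.const 1)
    simp only [one_mul] at h2
    rw [← hZ.integral_eval hμ 0 hg, h2, integral_sub (he.sub (.const 1)).integrable hfG.integrable,
      integral_sub he.integrable (integrable_const _)] at h1
    simp only [integral_const, probReal_univ, smul_eq_mul, mul_one] at h1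
    rw [hfU]
    linarith
  -- `|𝓛 U| ≤ 2 M U`, because `|e^{A_t} - 1| ≤ M ∫_0^t e^{A_s} ds`
  have hgU : ∫ z, g z ^ 2 ∂μ ≤ 4 * M ^ 2 * ∫ z, U z ^ 2 ∂μ := by
    have hle : ∀ w, |Real.exp (pathIntegral f Z t w) - 1 -
        f (Z 0 w) * expFunctional f Z t w| ≤ (2 * M) • expFunctional f Z t w := fun w => by
      refine (abs_sub _ _).trans ?_
      have h1 := abs_exp_integral_sub_one_le (measurable_eval_path hf hZ.measurable w)
        (fun _ => hM _) ht
      have h2 : |f (Z 0 w) * expFunctional f Z t w| ≤ M * expFunctional f Z t w := by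
        rw [abs_mul, abs_of_nonneg (expFunctional_nonneg ht w)]
        exact mul_le_mul_of_nonneg_right (hM _) (expFunctional_nonneg ht w)
      calc _ ≤ M * expFunctional f Z t w + M * expFunctional f Z t w := add_le_add h1 h2
        _ = (2 * M) • expFunctional f Z t w := by rw [smul_eq_mul]; ring
    have e1 := abs_condExp_ae_le_condExp_abs (μ := Pr)
      (m := MeasurableSpace.comap (Z 0) inferInstance) (fun w =>
        Real.exp (pathIntegral f Z t w) - 1 - f (Z 0 w) * expFunctional f Z t w)
    have e2 := condExp_mono (μ := Pr) (m := MeasurableSpace.comap (Z 0) inferInstance)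
      hD.integrable.abs (hG.integrable.smul (2 * M)) (Eventually.of_forall hle)
    have e3 := condExp_smul (μ := Pr) (2 * M) (expFunctional f Z t)
      (MeasurableSpace.comap (Z 0) inferInstance)
    have e4 : ∀ᵐ w ∂Pr, g (Z 0 w) ^ 2 ≤ 4 * M ^ 2 * U (Z 0 w) ^ 2 := by
      filter_upwards [e1, e2, e3, hU', hg'] with w e1 e2 e3 hUw hgw
      have e5 : |g (Z 0 w)| ≤ 2 * M * U (Z 0 w) := by
        rw [hUw, hgw]
        rw [Pi.smul_apply, smul_eq_mul] at e3
        exact e1.trans (e2.trans e3.le)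
      calc g (Z 0 w) ^ 2 = |g (Z 0 w)| ^ 2 := (sq_abs _).symm
        _ ≤ (2 * M * U (Z 0 w)) ^ 2 := pow_le_pow_left₀ (abs_nonneg _) e5 2
        _ = 4 * M ^ 2 * U (Z 0 w) ^ 2 := by ring
    rw [← hZ.integral_eval hμ 0 (hg.pow 2), ← hZ.integral_eval hμ 0 (hU.pow 2),
      ← integral_const_mul]
    exact integral_mono_ae ((hg.pow 2).comp h0).integrable
      (((hU.pow 2).comp h0).const_mul _).integrable e4
  -- solve the iterated Poincaré inequality for the variance of `U`
  set c := √(1 - 4 * M ^ 2 / η ^ 2)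
  have hc0 : 0 < c := Real.sqrt_pos.2 hc
  have hc2 : c ^ 2 = 1 - 4 * M ^ 2 / η ^ 2 := Real.sq_sqrt hc.le
  have hvar : variance U μ = (∫ z, U z ^ 2 ∂μ) - m ^ 2 := by
    rw [variance_eq_sub (hU.memLp 2), hUm]
    rfl
  have hsd : √(variance U μ) ≤ 2 * M * m / (c * η) := by
    rw [Real.sqrt_le_left (by positivity)]
    have h1 := hIP U g hgen
    have h2 : (η ^ 2)⁻¹ * ∫ z, g z ^ 2 ∂μ ≤
        (η ^ 2)⁻¹ * (4 * M ^ 2 * (variance U μ + m ^ 2)) := by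
      rw [hvar, sub_add_cancel]
      gcongr
    have h3 : c ^ 2 * variance U μ ≤ 4 * M ^ 2 * m ^ 2 / η ^ 2 := by
      rw [hc2]
      have h4 := h1.trans h2
      have h5 : (η ^ 2)⁻¹ * (4 * M ^ 2 * (variance U μ + m ^ 2)) =
          4 * M ^ 2 / η ^ 2 * variance U μ + 4 * M ^ 2 * m ^ 2 / η ^ 2 := by
        field_simp
      linarith
    calc variance U μ = c ^ 2 * variance U μ / c ^ 2 := by field_simp
      _ ≤ 4 * M ^ 2 * m ^ 2 / η ^ 2 / c ^ 2 := by gcongr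
      _ = (2 * M * m / (c * η)) ^ 2 := by field_simp; ring
  have hcov : ∫ z, f z * U z ∂μ ≤ σ * √(variance U μ) := by
    have h1 := integral_mul_le_sqrt_mul_sqrt (ν := μ) hfb (hU.sub (.const m))
    have h2 : ∫ z, f z * (U z - m) ∂μ = ∫ z, f z * U z ∂μ := by
      simp only [mul_sub]
      rw [integral_sub (hfb.mul hU).integrable (hfb.mul (.const m)).integrable,
        integral_mul_const, hf_mean, zero_mul, sub_zero]
    have h3 : ∫ z, (U z - m) ^ 2 ∂μ = variance U μ := by
      rw [variance_eq_integral hU.1.aemeasurable, hUm]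
    have h4 : √(∫ z, f z ^ 2 ∂μ) ≤ σ := by
      rw [Real.sqrt_le_left hσ]
      rw [variance_of_integral_eq_zero hf.aemeasurable hf_mean] at hf_var
      exact hf_var
    rw [h2, h3] at h1
    exact h1.trans (mul_le_mul_of_nonneg_right h4 (Real.sqrt_nonneg _))
  rw [hmean]
  gcongr
  calc ∫ z, f z * U z ∂μ ≤ σ * (2 * M * m / (c * η)) :=
        hcov.trans (mul_le_mul_of_nonneg_left hsd hσ)
    _ = 2 * σ * M / (c * η) * m := by ring

theorem integral_exp_pathIntegral_le (hZ : P.Governs μ Pr Z) (hμ : P.IsStationary μ)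
    (hη : 0 < η) (hIP : P.IteratedPoincare μ η) (hf : Measurable f) (hf_mean : ∫ z, f z ∂μ = 0)
    (hM : ∀ z, |f z| ≤ M) (hσ : 0 ≤ σ) (hf_var : variance f μ ≤ σ ^ 2)
    (hc : 0 < 1 - 4 * M ^ 2 / η ^ 2) {t : ℝ} (ht : 0 ≤ t) :
    ∫ w, Real.exp (pathIntegral f Z t w) ∂Pr ≤
      Real.exp (2 * σ * M * t / (√(1 - 4 * M ^ 2 / η ^ 2) * η)) := by
  have hfb : BddMeasurable f := ⟨hf, M, hM⟩
  have hM0 : 0 ≤ M := by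
    obtain ⟨w⟩ : Nonempty S := nonempty_of_isProbabilityMeasure Pr
    exact (abs_nonneg _).trans (hM (Z 0 w))
  have h1 := le_exp_of_le_one_add_integral
    (continuous_integral_exp_pathIntegral (Pr := Pr) hfb hZ.measurable)
    (K := 2 * σ * M / (√(1 - 4 * M ^ 2 / η ^ 2) * η)) (by positivity) (fun s hs => ?_) ht
  · rwa [div_mul_eq_mul_div] at h1
  · have h2 := hZ.integral_exp_pathIntegral_le_one_add hμ hη hIP hf hf_mean hM hσ hf_var hc hs
    have h3 := integral_mul_expFunctional (Pr := Pr) hfb hZ.measurable (.const 1) hs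
    simp only [one_mul] at h3
    rwa [h3] at h2

end MarkovSemigroup.Governs

theorem proposition3p2
    {Ω : Type*} [TopologicalSpace Ω] [PolishSpace Ω] [MeasurableSpace Ω] [BorelSpace Ω]
    (μ : Measure Ω) [IsProbabilityMeasure μ]
    (P : MarkovSemigroup Ω) (hμ : P.IsStationary μ)
    {S : Type*} [MeasurableSpace S] (Pr : Measure S) [IsProbabilityMeasure Pr]
    (Z : ℝ≥0 → S → Ω) (hZ : P.Governs μ Pr Z)
    (η : ℝ) (hη : 0 < η) (hIP : P.IteratedPoincare μ η)
    (f : Ω → ℝ) (hf : Measurable f) (hf_mean : ∫ z, f z ∂μ = 0)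
    (M : ℝ) (hM : ∀ z, |f z| ≤ M)
    (σ : ℝ) (hσ : 0 ≤ σ) (hf_var : variance f μ ≤ σ ^ 2) :
    (0 < 1 - 4 * M ^ 2 / η ^ 2 → ∀ t : ℝ, 0 ≤ t →
      Integrable (fun w => Real.exp (pathIntegral f Z t w)) Pr ∧
      ∫ w, Real.exp (pathIntegral f Z t w) ∂Pr
        ≤ Real.exp (2 * σ * M * t / (Real.sqrt (1 - 4 * M ^ 2 / η ^ 2) * η))) ∧
    (∀ θ : ℝ, 2 * M * |θ| < η → ∀ t : ℝ, 0 ≤ t →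
      Integrable (fun w => Real.exp (θ * pathIntegral f Z t w)) Pr ∧
      ∫ w, Real.exp (θ * pathIntegral f Z t w) ∂Pr
        ≤ Real.exp (2 * σ * M * θ ^ 2 * t /
            (Real.sqrt (1 - 4 * θ ^ 2 * M ^ 2 / η ^ 2) * η))) := by
  refine ⟨fun hc t ht => ⟨(bddMeasurable_exp_pathIntegral ⟨hf, M, hM⟩ hZ.measurable t).integrable,
    hZ.integral_exp_pathIntegral_le hμ hη hIP hf hf_mean hM hσ hf_var hc ht⟩,
    fun θ hθ t ht => ?_⟩
  have hM0 : 0 ≤ M := by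
    obtain ⟨w⟩ : Nonempty S := nonempty_of_isProbabilityMeasure Pr
    exact (abs_nonneg _).trans (hM (Z 0 w))
  -- the bound for `θ` is the bound with `θ = 1` for the function `θ f`
  have hscale : ∀ w, θ * pathIntegral f Z t w = pathIntegral (fun z => θ * f z) Z t w := fun w =>
    (intervalIntegral.integral_const_mul _ _).symm
  have hM' : ∀ z, |θ * f z| ≤ |θ| * M := fun z => by
    rw [abs_mul]
    exact mul_le_mul_of_nonneg_left (hM z) (abs_nonneg θ)
  have hc : 0 < 1 - 4 * (|θ| * M) ^ 2 / η ^ 2 := by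
    have h1 : (2 * M * |θ|) ^ 2 < η ^ 2 := pow_lt_pow_left₀ hθ (by positivity) two_ne_zero
    rw [sub_pos, div_lt_one (by positivity)]
    linarith
  simp only [hscale]
  refine ⟨(bddMeasurable_exp_pathIntegral ⟨hf.const_mul θ, |θ| * M, hM'⟩
    hZ.measurable t).integrable, ?_⟩
  have h1 := hZ.integral_exp_pathIntegral_le hμ hη hIP (hf.const_mul θ)
    (by rw [integral_const_mul, hf_mean, mul_zero]) hM' (σ := |θ| * σ) (by positivity)
    (by rw [variance_const_mul, mul_pow, sq_abs]; gcongr) hc ht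
  refine h1.trans (le_of_eq ?_)
  have h2 : 4 * (|θ| * M) ^ 2 / η ^ 2 = 4 * θ ^ 2 * M ^ 2 / η ^ 2 := by
    rw [mul_pow, sq_abs, mul_assoc]
  have h3 : 2 * (|θ| * σ) * (|θ| * M) * t = 2 * σ * M * θ ^ 2 * t := by
    rw [← sq_abs θ]; ring
  rw [h2, h3]
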